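/- **Setting.** For each sample size $n$ let $X=X_n\in\mathbb R^{n\times p_n}$ be a design matrix of rank $R=R_n$ such that $X_S^TX_S$ is nonsingular for every $S\subseteq\{1,\dots,p_n\}$ with $|S|\le R$ (where $X_S$ consists of the columns of $X$ with index in $S$); let $\beta^\star=\beta^\star_n\in\mathbb R^{p_n}$ have support $S^\star=\{j:\beta^\star_j\ne0\}$ of size $s^\star\le R$ for all large $n$; let $\sigma_0=\sigma_{0,n}>0$; let $P_{\beta^\star}$, $E_{\beta^\star}$ refer to the true model $y\sim N_n(X\beta^\star,\sigma_0^2I_n)$; and let $x=x_n\in\mathbb R^{p_n}$. Fix constants $a,c,a_0,b_0>0$, $0<\alpha<1$ and $\gamma>0$. Put $\hat\beta_S=(X_S^TX_S)^{-1}X_S^Ty$. The empirical prior $\Pi_n$ for $(\beta,\sigma^2)$ is: $\sigma^2\sim IG(a_0,b_0)$ (inverse gamma with shape $a_0$ and scale $b_0$); independently of $\sigma^2$, a model $S$ is drawn with probability $\pi(S)=\binom{p_n}{|S|}^{-1}f_n(|S|)$, where $f_n(s)\propto(cp_n^a)^{-s}$ for $s=0,\dots,R$ and $f_n(s)=0$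 for $s>R$; given $S$ and $\sigma^2$, $\beta_S\sim N(\hat\beta_S,\sigma^2\gamma^{-1}(X_S^TX_S)^{-1})$ and $\beta_{S^c}=0$. The posterior $\Pi^n$ of $\beta$ is the $\beta$-marginal of the probability measure proportional to $L^\alpha\,d\Pi_n$, with the fractional likelihood $L^\alpha(\beta,\sigma^2)=(2\pi\sigma^2)^{-n\alpha/2}\exp(-\frac{\alpha}{2\sigma^2}\|y-X\beta\|^2)$, and $\pi^n(S)$ is the posterior probability of the model $S$. **Statement (valid uncertainty quantification).** Let $\alpha+\gamma\le1$, let $\delta\in(0,1)$, and assume that $\delta\le\frac12$ or $\alpha+\gamma=1$. Let $t_\delta=\inf\{t:\Pi^n(\{\beta:x^T\beta\le t\})\ge1-\delta\}$ be the posterior $(1-\delta)$-quantile of $x^T\beta$. (i) If $$E_{\beta^\star}\,d_{TV}\Big(\Pi^n,\;N_{s^\star}\big(\hat\beta_{S^\star},\tfrac{\sigma_0^2}{\alpha+\gamma}(X_{S^\star}^TX_{S^\star})^{-1}\big)\otimes\delta_{0}\Big)\to0\qquad(n\to\infty),$$ where $\delta_0$ is the point mass at the origin for $\beta_{S^{\star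 c}}$ and $d_{TV}$ is the total variation distance, then $$P_{\beta^\star}(t_\delta\ge x^T\beta^\star)\ge1-\delta+o(1),\qquad n\to\infty.$$ (ii) The same conclusion holds if $d_1<\sigma_0^2<d_2$ for all $n$ with constants $0<d_1<d_2<\infty$, $s^\star=o(\sqrt n/\log n)$ and $E_{\beta^\star}\pi^n(S^\star)\to1$. In particular, $\delta=\gamma$ is allowed if $\gamma\le\frac12$ or $\alpha+\gamma=1$. -/

import Mathlib

open MeasureTheory ProbabilityTheory Filter Topology Asymptotics
open scoped Matrix ENNReal

noncomputable section

namespace EmpiricalPrior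

/-- The numerical constants of the empirical prior and of the fractional likelihood:
`a, c` enter the prior on the model size, `a₀, b₀` are the shape and the scale of the inverse gamma
prior on `σ²`, `α` is the power of the likelihood, and `γ` is the precision factor of the
conditional normal prior on the coefficients. -/
structure Hyper where
  a : ℝ
  c : ℝ
  a₀ : ℝ
  b₀ : ℝ
  α : ℝ
  γ : ℝ

variable {n p : ℕ}

/-- The support `S_β = {j : β_j ≠ 0}`. -/
def supp (β : EuclideanSpace ℝ (Fin p)) : Finset (Fin p) :=
  Finset.univ.filter fun j => β j ≠ 0

/-- The submatrix `X_S` of the columns of `X` with index in `S`. -/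
def cols (X : Matrix (Fin n) (Fin p) ℝ) (S : Finset (Fin p)) : Matrix (Fin n) S ℝ :=
  X.submatrix id Subtype.val

/-- The Gram matrix `X_Sᵀ X_S`. -/
def gram (X : Matrix (Fin n) (Fin p) ℝ) (S : Finset (Fin p)) : Matrix S S ℝ :=
  (cols X S)ᵀ * cols X S

/-- The least squares estimator `β̂_S = (X_Sᵀ X_S)⁻¹ X_Sᵀ y`. -/
def lse (X : Matrix (Fin n) (Fin p) ℝ) (S : Finset (Fin p)) (y : EuclideanSpace ℝ (Fin n)) :
    EuclideanSpace ℝ S :=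
  WithLp.toLp 2 ((gram X S)⁻¹ *ᵥ ((cols X S)ᵀ *ᵥ y.ofLp))

/-- A vector indexed by `S`, extended by zero outside `S`. Pushing a law `μ` on `ℝ^S` forward
along this map gives `μ ⊗ δ₀`, with the point mass at the origin of the coordinates off `S`. -/
def extend (S : Finset (Fin p)) (b : EuclideanSpace ℝ S) : EuclideanSpace ℝ (Fin p) :=
  WithLp.toLp 2 fun j => if h : j ∈ S then b ⟨j, h⟩ else 0

/-- The law `N_n(Xβ, σ² I_n)` of the response. -/
def responseLaw (X : Matrix (Fin n) (Fin p) ℝ) (β : EuclideanSpace ℝ (Fin p)) (σ : ℝ) :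
    Measure (EuclideanSpace ℝ (Fin n)) :=
  multivariateGaussian (WithLp.toLp 2 (X *ᵥ β.ofLp)) ((σ ^ 2) • (1 : Matrix (Fin n) (Fin n) ℝ))

/-- The inverse gamma law with shape `a₀` and scale `b₀`: the law of `1 / τ`, where `τ` has the
gamma law with shape `a₀` and rate `b₀`. -/
def invGamma (a₀ b₀ : ℝ) : Measure ℝ :=
  (gammaMeasure a₀ b₀).map fun τ => τ⁻¹

/-- The prior on the model size: `f_n(s) ∝ (c p^a)^{-s}` for `s = 0, …, R`, and `f_n(s) = 0` for
`s > R`, where `R` is the rank of `X`. -/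
def sizePrior (h : Hyper) (X : Matrix (Fin n) (Fin p) ℝ) (s : ℕ) : ℝ :=
  if s ≤ X.rank then
    ((h.c * (p : ℝ) ^ h.a) ^ s)⁻¹ /
      ∑ k ∈ Finset.range (X.rank + 1), ((h.c * (p : ℝ) ^ h.a) ^ k)⁻¹
  else 0

/-- The prior on the model: `π(S) = (p choose |S|)⁻¹ f_n(|S|)`. -/
def modelPrior (h : Hyper) (X : Matrix (Fin n) (Fin p) ℝ) (S : Finset (Fin p)) : ℝ :=
  ((p.choose S.card : ℕ) : ℝ)⁻¹ * sizePrior h X S.card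

/-- The prior law of `(β, σ²)` given the model `S`: `σ² ∼ IG(a₀, b₀)`, and given `σ²`,
`β_S ∼ N(β̂_S, σ² γ⁻¹ (X_Sᵀ X_S)⁻¹)` and `β` vanishes off `S`. The conditional normal law is written
as the law of `β̂_S + σ w` with `w ∼ N(0, γ⁻¹ (X_Sᵀ X_S)⁻¹)` independent of `σ²`. -/
def priorGiven (h : Hyper) (X : Matrix (Fin n) (Fin p) ℝ) (y : EuclideanSpace ℝ (Fin n))
    (S : Finset (Fin p)) : Measure (EuclideanSpace ℝ (Fin p) × ℝ) :=
  ((invGamma h.a₀ h.b₀).prod (multivariateGaussian 0 (h.γ⁻¹ • (gram X S)⁻¹))).map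
    fun q => (extend S (lse X S y + √q.1 • q.2), q.1)

/-- The empirical joint prior `Π_n` of `(β, σ²)`. -/
def prior (h : Hyper) (X : Matrix (Fin n) (Fin p) ℝ) (y : EuclideanSpace ℝ (Fin n)) :
    Measure (EuclideanSpace ℝ (Fin p) × ℝ) :=
  ∑ S : Finset (Fin p), ENNReal.ofReal (modelPrior h X S) • priorGiven h X y S

/-- The fractional likelihood
`L^α(β, σ²) = (2πσ²)^{-nα/2} exp(-α/(2σ²) ‖y - Xβ‖²)` at `q = (β, σ²)`. -/
def fracLik (α : ℝ) (X : Matrix (Fin n) (Fin p) ℝ) (y : EuclideanSpace ℝ (Fin n))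
    (q : EuclideanSpace ℝ (Fin p) × ℝ) : ℝ≥0∞ :=
  ENNReal.ofReal ((2 * Real.pi * q.2) ^ (-((n : ℝ) * α / 2)) *
    Real.exp (-(α / (2 * q.2)) * ‖y - WithLp.toLp 2 (X *ᵥ q.1.ofLp)‖ ^ 2))

/-- The normalizing constant `∫ L^α dΠ_n` of the posterior. -/
def evidence (h : Hyper) (X : Matrix (Fin n) (Fin p) ℝ) (y : EuclideanSpace ℝ (Fin n)) : ℝ≥0∞ :=
  ∫⁻ q, fracLik h.α X y q ∂prior h X y

/-- The empirical Bayes posterior law `Π^n` of `β`: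
`Π^n(B) = ∫_{B × (0,∞)} L^α dΠ_n / ∫ L^α dΠ_n`. -/
def posterior (h : Hyper) (X : Matrix (Fin n) (Fin p) ℝ) (y : EuclideanSpace ℝ (Fin n)) :
    Measure (EuclideanSpace ℝ (Fin p)) :=
  (evidence h X y)⁻¹ • ((prior h X y).withDensity (fracLik h.α X y)).map Prod.fst

/-- The marginal posterior probability `π^n(S)` of the model `S`. -/
def modelPosterior (h : Hyper) (X : Matrix (Fin n) (Fin p) ℝ) (y : EuclideanSpace ℝ (Fin n))
    (S : Finset (Fin p)) : ℝ≥0∞ :=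
  (ENNReal.ofReal (modelPrior h X S) * ∫⁻ q, fracLik h.α X y q ∂priorGiven h X y S) /
    evidence h X y

/-- The normal approximation `N(β̂_S, σ²/(α+γ) (X_Sᵀ X_S)⁻¹) ⊗ δ₀` of the posterior. -/
def normalApprox (h : Hyper) (X : Matrix (Fin n) (Fin p) ℝ) (y : EuclideanSpace ℝ (Fin n))
    (S : Finset (Fin p)) (σ : ℝ) : Measure (EuclideanSpace ℝ (Fin p)) :=
  (multivariateGaussian (lse X S y) ((σ ^ 2 / (h.α + h.γ)) • (gram X S)⁻¹)).map (extend S)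

/-- The total variation distance `sup_A |μ(A) - ν(A)|` of two probability measures. -/
def tvDist {E : Type*} [MeasurableSpace E] (μ ν : Measure E) : ℝ≥0∞ :=
  ⨆ (A : Set E) (_ : MeasurableSet A), ENNReal.ofReal |μ.real A - ν.real A|

/-- The posterior distribution function `H_n(t) = Π^n{β : xᵀβ ≤ t}` of `xᵀβ`. -/
def postCdf (h : Hyper) (X : Matrix (Fin n) (Fin p) ℝ) (y : EuclideanSpace ℝ (Fin n))
    (x : EuclideanSpace ℝ (Fin p)) (t : ℝ) : ℝ :=
  (posterior h X y).real {β | inner ℝ x β ≤ t}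

/-- The posterior `(1-δ)`-quantile `inf {t : H_n(t) ≥ 1 - δ}` of `xᵀβ`. -/
def postQuantile (h : Hyper) (X : Matrix (Fin n) (Fin p) ℝ) (x : EuclideanSpace ℝ (Fin p))
    (δ : ℝ) (y : EuclideanSpace ℝ (Fin n)) : ℝ :=
  sInf {t : ℝ | 1 - δ ≤ postCdf h X y x t}

/-- The probability, when `y ∼ N_n(Xβ, σ² I_n)`, that the posterior `(1-δ)`-quantile of `xᵀβ` is at
least its true value. -/
def coverage (h : Hyper) (X : Matrix (Fin n) (Fin p) ℝ) (β : EuclideanSpace ℝ (Fin p)) (σ : ℝ)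
    (x : EuclideanSpace ℝ (Fin p)) (δ : ℝ) : ℝ :=
  (responseLaw X β σ).real {y | inner ℝ x β ≤ postQuantile h X x δ y}

end EmpiricalPrior

end

namespace EmpiricalPrior

/-! ### The standard normal distribution function -/

/-! Write κ = α + γ, θ = xᵀβ*, S = S*, and let τ = `lseScale` be the standard deviation of xᵀβ̂_S in
units of σ₀. When τ > 0, Z = (θ - xᵀβ̂_S)/(σ₀τ) is standard normal under the truth. If the posterior
of xᵀβ is close to N(xᵀβ̂_S, σ₀²τ²/κ), the posterior mass of {xᵀβ < θ} is close to Φ(√κ Z). By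
`le_postQuantile` the quantile covers θ once this mass is below 1 - δ. For any q with Φ(q) < 1 - δ
this happens on {Z ≤ q/√κ}, up to a small exceptional event, so the coverage is at least Φ(q/√κ)
minus a small error (`sub_le_coverage`). Let q increase to the (1 - δ)-quantile q₀ of Φ. Then
Φ(q₀/√κ) ≥ 1 - δ, because either κ = 1, or q₀ ≥ 0 and κ ≤ 1 (`exists_quantile_gaussianReal`): the
posterior is at least as spread out as the sampling law of the estimator.

The two parts differ only in how the posterior mass of {xᵀβ < θ} is compared with Φ. In (i),
Markov's inequality turns the mean total variation bound into closeness on this one event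
(`coverage_ge_of_tvDist`).

In (ii) the posterior given S is computed exactly by conjugacy (`priorGiven_withDensity_fracLik`).
It is a scale mixture of normal laws whose precision 1/σ² is gamma with shape a₀ + nα/2 and rate b₀
+ (α/2)‖residual‖². The residual sum of squares is close to nσ₀² because s*/n → 0
(`responseLaw_residual_le`), so Chebyshev's inequality puts the precision near 1/σ₀². The remaining
models contribute at most 1 - π^n(S*) (`posterior_le_add`). The argument is assembled in
`coverage_ge_of_modelPosterior`.

Strict half-lines {xᵀβ < θ} and weak inequalities between scales are used throughout, so that the
degenerate case τ = 0, where the law of xᵀβ given S is a point mass, needs no separate treatment. -/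

instance nullSingletonClass_gaussianReal_zero_one : NullSingletonClass (gaussianReal 0 1) :=
  nullSingletonClass_gaussianReal one_ne_zero

theorem continuous_real_Iic (μ : Measure ℝ) [IsProbabilityMeasure μ] [NullSingletonClass μ] :
    Continuous fun q : ℝ => μ.real (Set.Iic q) := by
  have h : (fun q : ℝ => μ.real (Set.Iic q)) = cdf μ := by
    ext q; rw [cdf_eq_real]
  rw [h, continuous_iff_continuousAt]
  intro q
  rw [continuousAt_iff_continuous_left_right]
  refine ⟨?_, (cdf μ).right_continuous q⟩
  have h1 : Function.leftLim (cdf μ) q = cdf μ q := by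
    have h2 : (cdf μ).measure {q} = 0 := by rw [measure_cdf]; exact measure_singleton q
    rw [StieltjesFunction.measure_singleton, ENNReal.ofReal_eq_zero] at h2
    exact le_antisymm ((cdf μ).mono.leftLim_le le_rfl) (by linarith)
  exact continuousWithinAt_Iio_iff_Iic.1 ((cdf μ).mono.continuousWithinAt_Iio_iff_leftLim_eq.2 h1)

theorem exists_gaussianReal_Iic_eq {r : ℝ} (h₀ : 0 < r) (h₁ : r < 1) :
    ∃ q : ℝ, (gaussianReal 0 1).real (Set.Iic q) = r := by
  have hb := tendsto_cdf_atBot (gaussianReal 0 1)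
  have ht := tendsto_cdf_atTop (gaussianReal 0 1)
  obtain ⟨x, hx⟩ := (hb.eventually_lt_const h₀).exists
  obtain ⟨y, hy⟩ := (ht.eventually_const_lt h₁).exists
  rw [cdf_eq_real] at hx hy
  exact mem_range_of_exists_le_of_exists_ge (continuous_real_Iic _) ⟨x, hx.le⟩ ⟨y, hy.le⟩

theorem strictMono_gaussianReal_Iic :
    StrictMono fun q : ℝ => (gaussianReal 0 1).real (Set.Iic q) := by
  intro a b hab
  have h1 : (gaussianReal 0 1).real (Set.Iic b)
      = (gaussianReal 0 1).real (Set.Iic a) + (gaussianReal 0 1).real (Set.Ioc a b) := by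
    rw [← measureReal_union (Set.Iic_disjoint_Ioc le_rfl) measurableSet_Ioc,
      Set.Iic_union_Ioc_eq_Iic hab.le]
  have h2 : (gaussianReal 0 1) (Set.Ioc a b) ≠ 0 := by
    intro h0
    have := gaussianReal_absolutelyContinuous' 0 (one_ne_zero (α := NNReal)) h0
    rw [Real.volume_Ioc, ENNReal.ofReal_eq_zero] at this
    linarith
  have h3 : 0 < (gaussianReal 0 1).real (Set.Ioc a b) :=
    ENNReal.toReal_pos h2 (measure_ne_top _ _)
  simp only [h1]
  linarith

theorem gaussianReal_Iic_zero : (gaussianReal 0 1).real (Set.Iic 0) = 1 / 2 := by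
  have h1 : (gaussianReal 0 1).real (Set.Ici 0) = (gaussianReal 0 1).real (Set.Iic 0) := by
    have h := gaussianReal_map_neg (μ := 0) (v := 1)
    rw [neg_zero] at h
    conv_lhs => rw [← h]
    rw [map_measureReal_apply measurable_neg measurableSet_Ici]
    congr 1; ext x; simp
  have h2 : (gaussianReal 0 1).real (Set.Iic 0) + (gaussianReal 0 1).real (Set.Ioi 0) = 1 := by
    rw [← Set.compl_Iic, measureReal_add_measureReal_compl measurableSet_Iic]; simp
  have h3 : (gaussianReal 0 1).real (Set.Ioi 0) = (gaussianReal 0 1).real (Set.Ici 0) :=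
    measureReal_congr Ioi_ae_eq_Ici
  linarith

/-- Shrinking the scale of a normal law by `√κ` does not decrease the mass to the left of a
quantile of level at least `1 / 2`. -/
theorem exists_quantile_gaussianReal {δ κ : ℝ} (hδ₀ : 0 < δ) (hδ₁ : δ < 1) (hκ₀ : 0 < κ)
    (hκ₁ : κ ≤ 1) (hδ : δ ≤ 1 / 2 ∨ κ = 1) {η : ℝ} (hη : 0 < η) :
    ∃ q' q'' : ℝ, q' < q'' ∧ (gaussianReal 0 1).real (Set.Iic q'') < 1 - δ ∧
      1 - δ - η < (gaussianReal 0 1).real (Set.Iic (q' / √κ)) := by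
  obtain ⟨q, hq⟩ := exists_gaussianReal_Iic_eq (r := 1 - δ) (by linarith) (by linarith)
  have hκs : 0 < √κ := Real.sqrt_pos.2 hκ₀
  have hκs1 : √κ ≤ 1 := by rw [← Real.sqrt_one]; exact Real.sqrt_le_sqrt hκ₁
  have h1 : 1 - δ ≤ (gaussianReal 0 1).real (Set.Iic (q / √κ)) := by
    rcases hδ with hδ | rfl
    -- Φ(0) = 1/2 ≤ 1 - δ forces q ≥ 0, so dividing by √κ ≤ 1 moves q to the right.
    · have hq0 : 0 ≤ q := by
        by_contra! hneg
        have := strictMono_gaussianReal_Iic hneg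
        simp only [gaussianReal_Iic_zero, hq] at this
        linarith
      rw [← hq]
      apply strictMono_gaussianReal_Iic.monotone
      rw [le_div_iff₀ hκs]
      nlinarith
    · simp [hq]
  have hc : Continuous fun t : ℝ => (gaussianReal 0 1).real (Set.Iic (t / √κ)) :=
    (continuous_real_Iic (gaussianReal 0 1)).comp (continuous_id.div_const _)
  -- Moving slightly to the left of q costs less than η by continuity. The midpoint of t and q then
  -- leaves room on both sides: a strict gap below level 1 - δ, and a gap between the two quantiles
  -- that absorbs a perturbation of the scale.
  have h2 : ∀ᶠ t in 𝓝[<] q, 1 - δ - η < (gaussianReal 0 1).real (Set.Iic (t / √κ)) :=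
    ((hc.tendsto q).mono_left nhdsWithin_le_nhds).eventually_const_lt (by linarith)
  obtain ⟨t, ht, htq⟩ := (h2.and self_mem_nhdsWithin).exists
  replace htq : t < q := htq
  refine ⟨t, (t + q) / 2, by linarith, ?_, ht⟩
  rw [← hq]
  exact strictMono_gaussianReal_Iic (by linarith)

/-! ### Exponential tilting of normal and gamma laws -/

theorem map_withDensity_comp {A B : Type*} [MeasurableSpace A] [MeasurableSpace B]
    {μ : Measure A} {g : A → B} (hg : Measurable g) {f : B → ℝ≥0∞} (hf : Measurable f) :
    (μ.withDensity fun a => f (g a)).map g = (μ.map g).withDensity f := by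
  ext s hs
  rw [withDensity_apply _ hs, Measure.restrict_map hg hs, lintegral_map hf hg,
    Measure.map_apply hg hs, withDensity_apply _ (hg hs)]

/-- On a box, the integrand times the indicator is still a product of functions of single
coordinates, so independence factorizes the integral. -/
theorem pi_withDensity_prod {ι : Type*} [Fintype ι] (μ : Measure ℝ) [IsProbabilityMeasure μ]
    {f : ℝ → ℝ≥0∞} (hf : Measurable f) [SigmaFinite (μ.withDensity f)] :
    (Measure.pi fun _ : ι => μ).withDensity (fun z => ∏ i, f (z i)) =
      Measure.pi fun _ : ι => μ.withDensity f := by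
  symm
  refine Measure.pi_eq fun s hs => ?_
  rw [withDensity_apply _ (MeasurableSet.univ_pi hs),
    ← lintegral_indicator (MeasurableSet.univ_pi hs)]
  have h1 : ((Set.univ.pi s).indicator fun z : ι → ℝ => ∏ i, f (z i)) =
      fun z => ∏ i, (s i).indicator f (z i) := by
    ext z
    by_cases hz : z ∈ Set.univ.pi s
    · rw [Set.indicator_of_mem hz]
      exact Finset.prod_congr rfl fun i _ => (Set.indicator_of_mem (hz i trivial) _).symm
    · rw [Set.indicator_of_notMem hz]
      simp only [Set.mem_univ_pi, not_forall] at hz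
      obtain ⟨i, hi⟩ := hz
      exact (Finset.prod_eq_zero (Finset.mem_univ i) (Set.indicator_of_notMem hi _)).symm
  have hm : ∀ i, Measurable ((s i).indicator f) := fun i => hf.indicator (hs i)
  rw [h1, lintegral_prod_eq_prod_lintegral_of_indepFun Finset.univ
    (fun i (z : ι → ℝ) => (s i).indicator f (z i))
    (iIndepFun_pi (X := fun i => (s i).indicator f) fun i => (hm i).aemeasurable)
    (fun i => (hm i).comp (measurable_pi_apply i))]
  refine Finset.prod_congr rfl fun i _ => ?_
  rw [(measurePreserving_eval (fun _ : ι => μ) i).lintegral_comp (hm i),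
    lintegral_indicator (hs i), withDensity_apply _ (hs i)]

theorem pi_smul_measure {ι : Type*} [Fintype ι] (μ : Measure ℝ) [IsProbabilityMeasure μ]
    {C : ℝ≥0∞} (hC : C ≠ ∞) :
    (Measure.pi fun _ : ι => C • μ) = C ^ Fintype.card ι • Measure.pi fun _ : ι => μ := by
  have : IsFiniteMeasure (C • μ) := Measure.smul_finite μ hC
  refine Measure.pi_eq fun s hs => ?_
  simp [Finset.prod_mul_distrib, Measure.pi_pi]

/-- The exponents -x²/2 and -cx² add up to -x²/(2η²), and η is the ratio of the two normalizing
constants. -/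
theorem gaussianReal_withDensity_exp {c η : ℝ} (hη : 0 < η) (hcη : η ^ 2 * (1 + 2 * c) = 1) :
    (gaussianReal 0 1).withDensity (fun x => ENNReal.ofReal (Real.exp (-(c * x ^ 2)))) =
      ENNReal.ofReal η • (gaussianReal 0 1).map (fun x => η * x) := by
  have hv : (NNReal.mk (η ^ 2) (sq_nonneg _) * 1 : NNReal) ≠ 0 := by
    rw [mul_one]; intro h
    have := congrArg NNReal.toReal h
    simp at this; exact hη.ne' this
  rw [gaussianReal_map_const_mul, gaussianReal_of_var_ne_zero _ hv,
    gaussianReal_of_var_ne_zero _ one_ne_zero, ← withDensity_mul _ (by fun_prop) (by fun_prop),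
    ← withDensity_smul _ (by fun_prop)]
  congr 1
  ext x
  simp only [Pi.mul_apply, Pi.smul_apply, smul_eq_mul, gaussianPDF, gaussianPDFReal]
  rw [← ENNReal.ofReal_mul (by positivity), ← ENNReal.ofReal_mul hη.le]
  congr 1
  simp only [NNReal.coe_one, mul_one, mul_zero, sub_zero, NNReal.coe_mk]
  rw [Real.sqrt_mul (by positivity) (η ^ 2), Real.sqrt_sq hη.le, mul_inv, mul_assoc, ← Real.exp_add,
    ← mul_assoc, mul_comm η, mul_assoc _ _ η, inv_mul_cancel₀ hη.ne', mul_one]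
  congr 2
  have h2 : 1 + 2 * c = 1 / η ^ 2 := by field_simp; linarith
  have h3 : c = (1 / η ^ 2 - 1) / 2 := by linarith
  rw [h3]; field_simp; ring

/-- The tilt is a product over coordinates, so the one-dimensional case applies to each. The
constant need not be known, because it cancels when the posterior is normalized. -/
theorem stdGaussian_withDensity_exp {ι : Type*} [Fintype ι] {c η : ℝ} (hη : 0 < η)
    (hcη : η ^ 2 * (1 + 2 * c) = 1) :
    ∃ C : ℝ≥0∞, (stdGaussian (EuclideanSpace ℝ ι)).withDensity
        (fun z => ENNReal.ofReal (Real.exp (-(c * ‖z‖ ^ 2)))) =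
      C • (stdGaussian (EuclideanSpace ℝ ι)).map (fun z => η • z) := by
  refine ⟨ENNReal.ofReal η ^ Fintype.card ι, ?_⟩
  set f : ℝ → ℝ≥0∞ := fun x => ENNReal.ofReal (Real.exp (-(c * x ^ 2))) with hf
  have hfm : Measurable f := by fun_prop
  have h1 := gaussianReal_withDensity_exp hη hcη
  have hp : IsProbabilityMeasure ((gaussianReal 0 1).map fun x => η * x) :=
    Measure.isProbabilityMeasure_map (by fun_prop)
  have hfin : IsFiniteMeasure ((gaussianReal 0 1).withDensity f) := by
    rw [h1]; exact Measure.smul_finite _ ENNReal.ofReal_ne_top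
  have h2 := pi_withDensity_prod (ι := ι) (gaussianReal 0 1) hfm
  rw [h1, pi_smul_measure _ ENNReal.ofReal_ne_top] at h2
  have h3 : (fun z : EuclideanSpace ℝ ι => ENNReal.ofReal (Real.exp (-(c * ‖z‖ ^ 2)))) =
      fun z => ∏ i, f (z i) := by
    ext z
    rw [EuclideanSpace.real_norm_sq_eq, Finset.mul_sum, ← Finset.sum_neg_distrib, Real.exp_sum,
      ENNReal.ofReal_prod_of_nonneg fun i _ => (Real.exp_pos _).le]
  have hL : Measurable (WithLp.toLp 2 : (ι → ℝ) → EuclideanSpace ℝ ι) :=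
    WithLp.measurable_toLp 2 _
  have hη1 : Measurable fun (z : ι → ℝ) i => η * z i := by fun_prop
  have hη2 : Measurable fun z : EuclideanSpace ℝ ι => η • z := by fun_prop
  have h4 : (Measure.pi fun _ : ι => (gaussianReal 0 1).map fun x => η * x) =
      (Measure.pi fun _ : ι => gaussianReal 0 1).map fun z i => η * z i :=
    (Measure.pi_map_pi (fun _ => by fun_prop)).symm
  rw [h3, ← map_pi_eq_stdGaussian, ← map_withDensity_comp hL (by fun_prop), h2, h4,
    Measure.map_smul, Measure.map_map hL hη1, Measure.map_map hη2 hL]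
  rfl

/-- Conjugacy of the gamma law: as a function of the precision t, the likelihood contributes a power
of t and an exponential, which only shift the shape and the rate. -/
theorem gammaMeasure_withDensity_rpow_mul_exp {a r k b : ℝ} (ha : 0 < a) (hr : 0 < r) (hk : 0 ≤ k)
    (hb : 0 ≤ b) :
    (gammaMeasure a r).withDensity (fun t => ENNReal.ofReal (t ^ k * Real.exp (-(b * t)))) =
      ENNReal.ofReal (r ^ a / Real.Gamma a * (Real.Gamma (a + k) / (r + b) ^ (a + k))) •
        gammaMeasure (a + k) (r + b) := by
  have hm : ∀ a r, Measurable (gammaPDF a r) := fun a r =>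
    (measurable_gammaPDFReal a r).ennreal_ofReal
  have hG := Real.Gamma_pos_of_pos ha
  have hG' := Real.Gamma_pos_of_pos (by linarith : 0 < a + k)
  have hrb : 0 < r + b := by linarith
  rw [gammaMeasure, gammaMeasure, ← withDensity_mul _ (hm _ _) (by fun_prop),
    ← withDensity_smul _ (hm _ _)]
  refine withDensity_congr_ae ?_
  have h0 : ∀ᵐ t : ℝ, t ≠ 0 := by
    rw [ae_iff]; simp
  filter_upwards [h0] with t ht
  simp only [Pi.mul_apply, Pi.smul_apply, smul_eq_mul]
  rcases lt_or_gt_of_ne ht with ht | ht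
  · simp [gammaPDF_of_neg ht]
  · rw [gammaPDF_of_nonneg ht.le, gammaPDF_of_nonneg ht.le, ← ENNReal.ofReal_mul (by positivity),
      ← ENNReal.ofReal_mul (by positivity)]
    congr 1
    rw [show a + k - 1 = (a - 1) + k by ring, Real.rpow_add ht,
      show -((r + b) * t) = -(r * t) + -(b * t) by ring, Real.exp_add]
    have : (r + b) ^ (a + k) ≠ 0 := (Real.rpow_pos_of_pos hrb _).ne'
    field_simp

theorem ae_pos_gammaMeasure (a r : ℝ) : ∀ᵐ t ∂gammaMeasure a r, 0 < t := by
  have hm : Measurable (gammaPDF a r) := (measurable_gammaPDFReal a r).ennreal_ofReal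
  rw [gammaMeasure, ae_withDensity_iff hm]
  have h0 : ∀ᵐ t : ℝ, t ≠ 0 := by
    rw [ae_iff]; simp
  filter_upwards [h0] with t ht hp
  rcases lt_or_gt_of_ne ht with ht | ht
  · exact absurd (gammaPDF_of_neg ht) hp
  · exact ht

theorem lintegral_rpow_gammaMeasure {a r k : ℝ} (ha : 0 < a) (hr : 0 < r) (hk : 0 ≤ k) :
    ∫⁻ t, ENNReal.ofReal (t ^ k) ∂gammaMeasure a r =
      ENNReal.ofReal (Real.Gamma (a + k) / (Real.Gamma a * r ^ k)) := by
  have h := congrArg (fun μ : Measure ℝ => μ Set.univ)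
    (gammaMeasure_withDensity_rpow_mul_exp ha hr hk le_rfl)
  have hp := isProbabilityMeasure_gammaMeasure (a := a + k) (r := r) (by linarith) hr
  simp only [zero_mul, neg_zero, Real.exp_zero, mul_one, add_zero, Measure.smul_apply,
    smul_eq_mul, measure_univ, withDensity_apply _ MeasurableSet.univ, Measure.restrict_univ] at h
  rw [h, Real.rpow_add hr]
  congr 1
  have := Real.Gamma_pos_of_pos ha
  have := (Real.rpow_pos_of_pos hr a).ne'
  field_simp

theorem integrable_and_integral_pow_gammaMeasure {a r : ℝ} (ha : 0 < a) (hr : 0 < r) (k : ℕ) :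
    Integrable (fun t => t ^ k) (gammaMeasure a r) ∧
      ∫ t, t ^ k ∂gammaMeasure a r = Real.Gamma (a + k) / (Real.Gamma a * r ^ k) := by
  have h := lintegral_rpow_gammaMeasure ha hr (k := k) (Nat.cast_nonneg k)
  simp only [Real.rpow_natCast] at h
  have hpos : 0 ≤ᵐ[gammaMeasure a r] fun t => t ^ k := by
    filter_upwards [ae_pos_gammaMeasure a r] with t ht
    exact (pow_pos ht k).le
  have hG := Real.Gamma_pos_of_pos ha
  have hG' := Real.Gamma_pos_of_pos (by positivity : 0 < a + k)
  constructor
  · refine ⟨by fun_prop, ?_⟩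
    rw [hasFiniteIntegral_iff_ofReal hpos, h]
    exact ENNReal.ofReal_lt_top
  · rw [integral_eq_lintegral_of_nonneg_ae hpos (by fun_prop), h, ENNReal.toReal_ofReal]
    positivity

/-- Chebyshev's inequality for the gamma law. -/
theorem gammaMeasure_abs_sub_mean_ge_le {a r ρ : ℝ} (ha : 0 < a) (hr : 0 < r) (hρ : 0 < ρ) :
    gammaMeasure a r {t | ρ ≤ |t - a / r|} ≤ ENNReal.ofReal (a / r ^ 2 / ρ ^ 2) := by
  have hp := isProbabilityMeasure_gammaMeasure ha hr
  obtain ⟨i1, e1⟩ := integrable_and_integral_pow_gammaMeasure ha hr 1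
  obtain ⟨i2, e2⟩ := integrable_and_integral_pow_gammaMeasure ha hr 2
  have hG := Real.Gamma_pos_of_pos ha
  have g1 : Real.Gamma (a + (1 : ℕ)) = a * Real.Gamma a := by
    rw [Nat.cast_one, Real.Gamma_add_one ha.ne']
  have g2 : Real.Gamma (a + (2 : ℕ)) = (a + 1) * (a * Real.Gamma a) := by
    rw [show a + ((2 : ℕ) : ℝ) = (a + 1) + 1 by push_cast; ring, Real.Gamma_add_one (by linarith),
      Real.Gamma_add_one ha.ne']
  rw [g1] at e1
  rw [g2] at e2
  simp only [pow_one] at e1 i1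
  have hL : MemLp (fun t : ℝ => t) 2 (gammaMeasure a r) :=
    (memLp_two_iff_integrable_sq (by fun_prop)).2 i2
  have e1' : ∫ t, t ∂gammaMeasure a r = a / r := by rw [e1]; field_simp
  have hV : Var[fun t : ℝ => t; gammaMeasure a r] = a / r ^ 2 := by
    -- The second moment is a(a + 1)/r² and the mean a/r, so the variance is a/r².
    rw [variance_eq_sub hL]
    simp only [Pi.pow_apply]
    rw [e1', e2]
    field_simp
    ring
  have := meas_ge_le_variance_div_sq hL hρ
  rwa [hV, e1'] at this

/-! ### Linear images of Gaussian laws -/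

theorem stdGaussian_map_inner {E : Type*} [NormedAddCommGroup E] [InnerProductSpace ℝ E]
    [FiniteDimensional ℝ E] [MeasurableSpace E] [BorelSpace E] (u : E) :
    (stdGaussian E).map (fun z => inner ℝ u z) = (gaussianReal 0 1).map (fun g => ‖u‖ * g) := by
  have h := IsGaussian.map_eq_gaussianReal (μ := stdGaussian E) (innerSL ℝ u)
  rw [integral_strongDual_stdGaussian, variance_dual_stdGaussian, innerSL_apply_norm] at h
  rw [gaussianReal_map_const_mul, mul_zero, mul_one]
  change (stdGaussian E).map (innerSL ℝ u) = _
  rw [h]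
  congr 1
  exact Real.toNNReal_of_nonneg (sq_nonneg _)

variable {n p : ℕ}

/-! ### Linear algebra of least squares -/

theorem norm_sq_toLp {ι : Type*} [Fintype ι] (v : ι → ℝ) :
    ‖(WithLp.toLp 2 v : EuclideanSpace ℝ ι)‖ ^ 2 = v ⬝ᵥ v := by
  rw [EuclideanSpace.real_norm_sq_eq]
  simp [dotProduct, sq]

theorem inner_eq_dotProduct {ι : Type*} [Fintype ι] (u v : EuclideanSpace ℝ ι) :
    inner ℝ u v = u.ofLp ⬝ᵥ v.ofLp := by
  rw [EuclideanSpace.inner_eq_star_dotProduct, dotProduct_comm]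
  simp

theorem continuous_toLp_mulVec {ι κ : Type*} [Fintype ι] [Fintype κ] (M : Matrix κ ι ℝ) :
    Continuous fun b : EuclideanSpace ℝ ι => (WithLp.toLp 2 (M *ᵥ b.ofLp) : EuclideanSpace ℝ κ) :=
  (PiLp.continuous_toLp 2 _).comp
    (Continuous.matrix_mulVec continuous_const (PiLp.continuous_ofLp 2 _))

/-- The restriction of a vector to the coordinates in `S`. -/
def restr (S : Finset (Fin p)) (x : EuclideanSpace ℝ (Fin p)) : EuclideanSpace ℝ S :=
  WithLp.toLp 2 fun j => x j

theorem inner_extend (S : Finset (Fin p)) (x : EuclideanSpace ℝ (Fin p)) (b : EuclideanSpace ℝ S) :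
    inner ℝ x (extend S b) = inner ℝ (restr S x) b := by
  rw [inner_eq_dotProduct, inner_eq_dotProduct]
  simp only [dotProduct, extend, restr]
  rw [← Finset.sum_subset (Finset.subset_univ S), ← Finset.sum_coe_sort S]
  · exact Finset.sum_congr rfl fun j _ => by simp
  · intro j _ hj
    simp [hj]

theorem extend_restr_supp (β : EuclideanSpace ℝ (Fin p)) :
    extend (supp β) (restr (supp β) β) = β := by
  ext j
  by_cases hj : j ∈ supp β
  · simp [extend, restr, hj]
  · have : β j = 0 := by simpa [supp] using hj
    simp [extend, hj, this]

theorem continuous_extend (S : Finset (Fin p)) : Continuous (extend S) := by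
  refine (PiLp.continuous_toLp 2 _).comp (continuous_pi fun j => ?_)
  by_cases hj : j ∈ S
  · simp only [hj, dite_true]; fun_prop
  · simp only [hj, dite_false]; fun_prop

theorem mulVec_extend (X : Matrix (Fin n) (Fin p) ℝ) (S : Finset (Fin p))
    (b : EuclideanSpace ℝ S) : X *ᵥ (extend S b).ofLp = cols X S *ᵥ b.ofLp := by
  ext i
  simp only [Matrix.mulVec, dotProduct, extend, cols, Matrix.submatrix_apply, id]
  rw [← Finset.sum_subset (Finset.subset_univ S), ← Finset.sum_coe_sort S]
  · exact Finset.sum_congr rfl fun j _ => by simp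
  · intro j _ hj
    simp [hj]

theorem continuous_lse (X : Matrix (Fin n) (Fin p) ℝ) (S : Finset (Fin p)) :
    Continuous (lse X S) := by
  have h := (continuous_toLp_mulVec (gram X S)⁻¹).comp (continuous_toLp_mulVec (cols X S)ᵀ)
  exact h

theorem posDef_gram {X : Matrix (Fin n) (Fin p) ℝ} {S : Finset (Fin p)}
    (hG : IsUnit (gram X S).det) : (gram X S).PosDef := by
  have h : (gram X S).PosSemidef := by
    have := Matrix.posSemidef_conjTranspose_mul_self (cols X S)
    rwa [Matrix.conjTranspose_eq_transpose_of_trivial] at this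
  exact (h.posDef_iff_isUnit).2 ((Matrix.isUnit_iff_isUnit_det _).2 hG)

theorem lse_add (X : Matrix (Fin n) (Fin p) ℝ) (S : Finset (Fin p))
    (y z : EuclideanSpace ℝ (Fin n)) : lse X S (y + z) = lse X S y + lse X S z := by
  simp [lse, Matrix.mulVec_add]

theorem lse_smul (X : Matrix (Fin n) (Fin p) ℝ) (S : Finset (Fin p)) (c : ℝ)
    (y : EuclideanSpace ℝ (Fin n)) : lse X S (c • y) = c • lse X S y := by
  simp [lse, Matrix.mulVec_smul]

theorem lse_cols_mulVec {X : Matrix (Fin n) (Fin p) ℝ} {S : Finset (Fin p)}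
    (hG : IsUnit (gram X S).det) (b : EuclideanSpace ℝ S) :
    lse X S (WithLp.toLp 2 (cols X S *ᵥ b.ofLp)) = b := by
  simp only [lse, Matrix.mulVec_mulVec]
  rw [← Matrix.mul_assoc, Matrix.mul_assoc, ← gram, Matrix.nonsing_inv_mul _ hG, Matrix.one_mulVec]

theorem lse_mulVec_supp {X : Matrix (Fin n) (Fin p) ℝ} {β : EuclideanSpace ℝ (Fin p)}
    (hG : IsUnit (gram X (supp β)).det) :
    lse X (supp β) (WithLp.toLp 2 (X *ᵥ β.ofLp)) = restr (supp β) β := by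
  have h := mulVec_extend X (supp β) (restr (supp β) β)
  rw [extend_restr_supp] at h
  rw [h, lse_cols_mulVec hG]

/-- The residual vector of the least squares fit in the model `S`. -/
noncomputable def residual (X : Matrix (Fin n) (Fin p) ℝ) (S : Finset (Fin p))
    (y : EuclideanSpace ℝ (Fin n)) : EuclideanSpace ℝ (Fin n) :=
  y - WithLp.toLp 2 (cols X S *ᵥ (lse X S y).ofLp)

theorem continuous_residual (X : Matrix (Fin n) (Fin p) ℝ) (S : Finset (Fin p)) :
    Continuous (residual X S) :=
  continuous_id.sub ((continuous_toLp_mulVec _).comp (continuous_lse X S))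

theorem residual_orthogonal {X : Matrix (Fin n) (Fin p) ℝ} {S : Finset (Fin p)}
    (hG : IsUnit (gram X S).det) (y : EuclideanSpace ℝ (Fin n)) (w : S → ℝ) :
    inner ℝ (residual X S y) (WithLp.toLp 2 (cols X S *ᵥ w)) = 0 := by
  rw [inner_eq_dotProduct, Matrix.dotProduct_mulVec]
  have : (residual X S y).ofLp ᵥ* cols X S = 0 := by
    rw [← Matrix.mulVec_transpose, residual, WithLp.ofLp_sub, Matrix.mulVec_sub]
    simp only [lse, Matrix.mulVec_mulVec]
    rw [← Matrix.mul_assoc, ← Matrix.mul_assoc, ← gram, Matrix.mul_nonsing_inv _ hG, Matrix.one_mul,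
      sub_self]
  rw [this, zero_dotProduct]

theorem norm_sq_sub_extend {X : Matrix (Fin n) (Fin p) ℝ} {S : Finset (Fin p)}
    (hG : IsUnit (gram X S).det) (y : EuclideanSpace ℝ (Fin n)) (w : EuclideanSpace ℝ S) :
    ‖y - WithLp.toLp 2 (X *ᵥ (extend S (lse X S y + w)).ofLp)‖ ^ 2 =
      ‖residual X S y‖ ^ 2 + w.ofLp ⬝ᵥ gram X S *ᵥ w.ofLp := by
  have h1 : y - WithLp.toLp 2 (X *ᵥ (extend S (lse X S y + w)).ofLp) =
      residual X S y - WithLp.toLp 2 (cols X S *ᵥ w.ofLp) := by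
    rw [mulVec_extend, residual, WithLp.ofLp_add, Matrix.mulVec_add, WithLp.toLp_add]
    abel
  rw [h1, @norm_sub_sq_real, residual_orthogonal hG, norm_sq_toLp (cols X S *ᵥ w.ofLp), gram,
    ← Matrix.mulVec_mulVec, Matrix.dotProduct_mulVec w.ofLp, ← Matrix.mulVec_transpose,
    Matrix.transpose_transpose]
  ring

/-! ### Multivariate Gaussian laws -/

section sqrt

open scoped MatrixOrder

theorem sqrt_mul_sqrt_of_posSemidef {ι : Type*} [Fintype ι] [DecidableEq ι] {V : Matrix ι ι ℝ}
    (hV : V.PosSemidef) : CFC.sqrt V * CFC.sqrt V = V :=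
  CFC.sqrt_mul_sqrt_self V hV.nonneg

theorem transpose_sqrt {ι : Type*} [Fintype ι] [DecidableEq ι] (V : Matrix ι ι ℝ) :
    (CFC.sqrt V)ᵀ = CFC.sqrt V := by
  have h : (CFC.sqrt V).PosSemidef := Matrix.nonneg_iff_posSemidef.1 (CFC.sqrt_nonneg V)
  have := h.isHermitian
  rwa [Matrix.IsHermitian, Matrix.conjTranspose_eq_transpose_of_trivial] at this

theorem sqrt_sq_smul_one {ι : Type*} [Fintype ι] [DecidableEq ι] {σ : ℝ} (hσ : 0 ≤ σ) :
    CFC.sqrt ((σ ^ 2) • (1 : Matrix ι ι ℝ)) = σ • (1 : Matrix ι ι ℝ) := by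
  have h : (0 : Matrix ι ι ℝ) ≤ σ • (1 : Matrix ι ι ℝ) :=
    (Matrix.PosSemidef.one.smul hσ).nonneg
  refine CFC.sqrt_unique ?_ h
  simp [smul_smul, sq]

theorem multivariateGaussian_eq_map {ι : Type*} [Fintype ι] [DecidableEq ι]
    (m : EuclideanSpace ℝ ι) (V : Matrix ι ι ℝ) :
    multivariateGaussian m V = (stdGaussian (EuclideanSpace ℝ ι)).map
      fun z => m + WithLp.toLp 2 (CFC.sqrt V *ᵥ z.ofLp) := by
  rw [multivariateGaussian]
  rfl

theorem responseLaw_eq_map (X : Matrix (Fin n) (Fin p) ℝ) (β : EuclideanSpace ℝ (Fin p)) {σ : ℝ}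
    (hσ : 0 ≤ σ) : responseLaw X β σ = (stdGaussian (EuclideanSpace ℝ (Fin n))).map
      fun e => WithLp.toLp 2 (X *ᵥ β.ofLp) + σ • e := by
  rw [responseLaw, multivariateGaussian_eq_map, sqrt_sq_smul_one hσ]
  simp [Matrix.smul_mulVec]

theorem inner_mulVec_right {ι κ : Type*} [Fintype ι] [Fintype κ] (u : EuclideanSpace ℝ κ)
    (M : Matrix κ ι ℝ) (z : EuclideanSpace ℝ ι) :
    inner ℝ u (WithLp.toLp 2 (M *ᵥ z.ofLp)) = inner ℝ (WithLp.toLp 2 (Mᵀ *ᵥ u.ofLp)) z := by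
  rw [inner_eq_dotProduct, inner_eq_dotProduct, Matrix.dotProduct_mulVec, Matrix.mulVec_transpose]

theorem norm_sqrt_mulVec {ι : Type*} [Fintype ι] [DecidableEq ι] {V : Matrix ι ι ℝ}
    (hV : V.PosSemidef) (u : EuclideanSpace ℝ ι) :
    ‖(WithLp.toLp 2 (CFC.sqrt V *ᵥ u.ofLp) : EuclideanSpace ℝ ι)‖ = √(u.ofLp ⬝ᵥ V *ᵥ u.ofLp) := by
  rw [← Real.sqrt_sq (norm_nonneg _), norm_sq_toLp, Matrix.dotProduct_mulVec,
    ← Matrix.mulVec_transpose, transpose_sqrt, Matrix.mulVec_mulVec, sqrt_mul_sqrt_of_posSemidef hV,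
    dotProduct_comm]

/-- A linear functional of a normal vector is affine in one standard normal variable. Writing it as
an image rather than through a density keeps variance zero within the same formula. -/
theorem multivariateGaussian_map_inner {ι : Type*} [Fintype ι] [DecidableEq ι] {V : Matrix ι ι ℝ}
    (hV : V.PosSemidef) (m u : EuclideanSpace ℝ ι) :
    (multivariateGaussian m V).map (fun b => inner ℝ u b) =
      (gaussianReal 0 1).map fun g => inner ℝ u m + √(u.ofLp ⬝ᵥ V *ᵥ u.ofLp) * g := by
  have hc := (continuous_toLp_mulVec (CFC.sqrt V)).measurable
  have h := stdGaussian_map_inner (WithLp.toLp 2 (CFC.sqrt V *ᵥ u.ofLp) : EuclideanSpace ℝ ι)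
  rw [norm_sqrt_mulVec hV] at h
  have h2 := congrArg (fun μ : Measure ℝ => μ.map fun s => inner ℝ u m + s) h
  simp only at h2
  rw [Measure.map_map (by fun_prop) (by fun_prop), Measure.map_map (by fun_prop) (by fun_prop)] at h2
  rw [multivariateGaussian_eq_map, Measure.map_map (by fun_prop) (by fun_prop)]
  refine Eq.trans ?_ h2
  congr 1
  ext z
  simp only [Function.comp_apply, inner_add_right, inner_mulVec_right, transpose_sqrt]

end sqrt

/-- The standard deviation, in units of `σ`, of the least squares estimator of `xᵀβ` in the
model `S`. -/
noncomputable def lseScale (X : Matrix (Fin n) (Fin p) ℝ) (S : Finset (Fin p))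
    (x : EuclideanSpace ℝ (Fin p)) : ℝ :=
  √((restr S x).ofLp ⬝ᵥ (gram X S)⁻¹ *ᵥ (restr S x).ofLp)

theorem lseScale_nonneg (X : Matrix (Fin n) (Fin p) ℝ) (S : Finset (Fin p))
    (x : EuclideanSpace ℝ (Fin p)) : 0 ≤ lseScale X S x := Real.sqrt_nonneg _

theorem transpose_gram (X : Matrix (Fin n) (Fin p) ℝ) (S : Finset (Fin p)) :
    (gram X S)ᵀ = gram X S := by
  rw [gram, Matrix.transpose_mul, Matrix.transpose_transpose]

theorem inner_lse_eq {X : Matrix (Fin n) (Fin p) ℝ} {S : Finset (Fin p)}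
    (x : EuclideanSpace ℝ (Fin p)) (e : EuclideanSpace ℝ (Fin n)) :
    inner ℝ (restr S x) (lse X S e) =
      inner ℝ (WithLp.toLp 2 (cols X S *ᵥ ((gram X S)⁻¹ *ᵥ (restr S x).ofLp))) e := by
  rw [inner_eq_dotProduct, inner_eq_dotProduct, lse, Matrix.dotProduct_mulVec,
    ← Matrix.mulVec_transpose, Matrix.transpose_nonsing_inv, transpose_gram,
    Matrix.dotProduct_mulVec, ← Matrix.mulVec_transpose, Matrix.transpose_transpose]

theorem norm_cols_mulVec_inv_gram {X : Matrix (Fin n) (Fin p) ℝ} {S : Finset (Fin p)}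
    (hG : IsUnit (gram X S).det) (x : EuclideanSpace ℝ (Fin p)) :
    ‖(WithLp.toLp 2 (cols X S *ᵥ ((gram X S)⁻¹ *ᵥ (restr S x).ofLp)) : EuclideanSpace ℝ (Fin n))‖ =
      lseScale X S x := by
  rw [← Real.sqrt_sq (norm_nonneg _), norm_sq_toLp, lseScale, Matrix.dotProduct_mulVec,
    ← Matrix.mulVec_transpose, Matrix.mulVec_mulVec, ← gram, Matrix.mulVec_mulVec,
    Matrix.mul_nonsing_inv _ hG, Matrix.one_mulVec]

theorem stdGaussian_map_inner_lse {X : Matrix (Fin n) (Fin p) ℝ} {S : Finset (Fin p)}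
    (hG : IsUnit (gram X S).det) (x : EuclideanSpace ℝ (Fin p)) :
    (stdGaussian (EuclideanSpace ℝ (Fin n))).map (fun e => inner ℝ (restr S x) (lse X S e)) =
      (gaussianReal 0 1).map fun g => lseScale X S x * g := by
  simp only [inner_lse_eq]
  rw [stdGaussian_map_inner, norm_cols_mulVec_inv_gram hG]

/-! ### The posterior given a model -/

theorem measurable_fracLik_uncurry (α : ℝ) (X : Matrix (Fin n) (Fin p) ℝ) :
    Measurable fun r : EuclideanSpace ℝ (Fin n) × (EuclideanSpace ℝ (Fin p) × ℝ) =>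
      fracLik α X r.1 r.2 := by
  have h := (continuous_toLp_mulVec X).measurable
  have h1 : Measurable fun r : EuclideanSpace ℝ (Fin n) × (EuclideanSpace ℝ (Fin p) × ℝ) =>
      ‖r.1 - WithLp.toLp 2 (X *ᵥ r.2.1.ofLp)‖ ^ 2 :=
    ((measurable_fst.sub (h.comp (measurable_fst.comp measurable_snd))).norm).pow_const 2
  unfold fracLik
  fun_prop

theorem measurable_fracLik (α : ℝ) (X : Matrix (Fin n) (Fin p) ℝ) (y : EuclideanSpace ℝ (Fin n)) :
    Measurable (fracLik α X y) :=
  (measurable_fracLik_uncurry α X).comp (measurable_const.prodMk measurable_id)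

section sqrt

open scoped MatrixOrder

/-- The square root A satisfies A² = γ⁻¹G⁻¹ for the Gram matrix G, so A and γAG are mutually
inverse. Multiplying them in the other order gives AGA = γ⁻¹I. -/
theorem sqrt_mulVec_gram {X : Matrix (Fin n) (Fin p) ℝ} {S : Finset (Fin p)}
    (hG : IsUnit (gram X S).det) {γ : ℝ} (hγ : 0 < γ) (z : S → ℝ) :
    (CFC.sqrt (γ⁻¹ • (gram X S)⁻¹) *ᵥ z) ⬝ᵥ gram X S *ᵥ (CFC.sqrt (γ⁻¹ • (gram X S)⁻¹) *ᵥ z) =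
      γ⁻¹ * (z ⬝ᵥ z) := by
  have hV : (γ⁻¹ • (gram X S)⁻¹).PosSemidef :=
    ((posDef_gram hG).inv.posSemidef).smul (inv_pos.2 hγ).le
  set A := CFC.sqrt (γ⁻¹ • (gram X S)⁻¹) with hA
  have hAA : A * A = γ⁻¹ • (gram X S)⁻¹ := sqrt_mul_sqrt_of_posSemidef hV
  have hAt : Aᵀ = A := transpose_sqrt _
  have h1 : A * (A * gram X S) = γ⁻¹ • 1 := by
    rw [← Matrix.mul_assoc, hAA, Matrix.smul_mul, Matrix.nonsing_inv_mul _ hG]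
  have h2 : (A * gram X S) * A = γ⁻¹ • 1 := by
    have h3 : A * (γ • (A * gram X S)) = 1 := by
      rw [Matrix.mul_smul, h1, smul_smul, mul_inv_cancel₀ hγ.ne', one_smul]
    have h4 := mul_eq_one_comm.1 h3
    rw [Matrix.smul_mul] at h4
    rw [← h4, smul_smul, inv_mul_cancel₀ hγ.ne', one_smul]
  rw [Matrix.dotProduct_mulVec, ← Matrix.mulVec_transpose, transpose_gram, Matrix.mulVec_mulVec,
    Matrix.dotProduct_mulVec, ← Matrix.mulVec_transpose, Matrix.mulVec_mulVec, hAt,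
    ← Matrix.mul_assoc]
  have h5 : A * gram X S * A = γ⁻¹ • 1 := h2
  rw [h5, Matrix.smul_mulVec, Matrix.one_mulVec, smul_dotProduct, smul_eq_mul]

/-- The prior given the model `S`, reweighted by the fractional likelihood, is a multiple of a
law of the same form with updated parameters. -/
theorem priorGiven_withDensity_fracLik (h : Hyper) (ha₀ : 0 < h.a₀) (hb₀ : 0 < h.b₀)
    (hα : 0 < h.α) (hγ : 0 < h.γ) {X : Matrix (Fin n) (Fin p) ℝ} {S : Finset (Fin p)}
    (hG : IsUnit (gram X S).det) (y : EuclideanSpace ℝ (Fin n)) :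
    ∃ C : ℝ≥0∞, (priorGiven h X y S).withDensity (fracLik h.α X y) =
      C • ((gammaMeasure (h.a₀ + n * h.α / 2) (h.b₀ + h.α / 2 * ‖residual X S y‖ ^ 2)).prod
        (stdGaussian (EuclideanSpace ℝ S))).map fun r =>
          (extend S (lse X S y + √(r.1⁻¹) • WithLp.toLp 2
            (CFC.sqrt (h.γ⁻¹ • (gram X S)⁻¹) *ᵥ (√(h.γ / (h.α + h.γ)) • r.2).ofLp)), r.1⁻¹) := by
  set A := CFC.sqrt (h.γ⁻¹ • (gram X S)⁻¹) with hA
  set η := √(h.γ / (h.α + h.γ)) with hη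
  set k := (n : ℝ) * h.α / 2 with hk
  set b := h.α / 2 * ‖residual X S y‖ ^ 2 with hb
  have hk0 : 0 ≤ k := by positivity
  have hb0 : 0 ≤ b := by positivity
  have hη0 : 0 < η := Real.sqrt_pos.2 (by positivity)
  -- With β_S = β̂_S + σAz, the likelihood exponent contributes (α/(2σ²))·σ²‖z‖²/γ, so z is tilted
  -- with c = α/(2γ). This shrinks its scale by η = √(γ/(α + γ)).
  have hcη : η ^ 2 * (1 + 2 * (h.α / (2 * h.γ))) = 1 := by
    rw [hη, Real.sq_sqrt (by positivity)]
    field_simp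
    ring
  obtain ⟨C₁, hC₁⟩ := stdGaussian_withDensity_exp (ι := S) hη0 hcη
  have hgam := gammaMeasure_withDensity_rpow_mul_exp ha₀ hb₀ hk0 hb0
  have hpg := isProbabilityMeasure_gammaMeasure ha₀ hb₀
  have hpg' := isProbabilityMeasure_gammaMeasure (a := h.a₀ + k) (r := h.b₀ + b)
    (by linarith) (by linarith)
  have hAm := (continuous_toLp_mulVec A).measurable
  have hem := (continuous_extend S).measurable
  set Ψ : ℝ × EuclideanSpace ℝ S → EuclideanSpace ℝ (Fin p) × ℝ := fun r =>
    (extend S (lse X S y + √(r.1⁻¹) • WithLp.toLp 2 (A *ᵥ r.2.ofLp)), r.1⁻¹) with hΨ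
  have hΨm : Measurable Ψ := by
    refine Measurable.prodMk (hem.comp ?_) (by fun_prop)
    have hs : Measurable fun r : ℝ × EuclideanSpace ℝ S => √(r.1⁻¹) := by fun_prop
    exact measurable_const.add (hs.smul (hAm.comp measurable_snd))
  have hprior : priorGiven h X y S =
      ((gammaMeasure h.a₀ h.b₀).prod (stdGaussian (EuclideanSpace ℝ S))).map Ψ := by
    have hm1 : Measurable fun t : ℝ => t⁻¹ := measurable_inv
    rw [priorGiven, invGamma, multivariateGaussian_eq_map, Measure.map_prod_map _ _ hm1
      (by simpa using hAm), Measure.map_map]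
    · congr 1
      ext r <;> simp [hΨ, hA]
    · refine Measurable.prodMk (hem.comp ?_) (by fun_prop)
      have hs : Measurable fun r : ℝ × EuclideanSpace ℝ S => √r.1 • r.2 := by fun_prop
      exact measurable_const.add hs
    · exact hm1.prodMap (by simpa using hAm)
  set f : ℝ → ℝ≥0∞ := fun t => ENNReal.ofReal (t ^ k * Real.exp (-(b * t))) with hf
  set g : EuclideanSpace ℝ S → ℝ≥0∞ := fun z =>
    ENNReal.ofReal (Real.exp (-(h.α / (2 * h.γ) * ‖z‖ ^ 2))) with hg
  set D : ℝ≥0∞ := ENNReal.ofReal ((2 * Real.pi) ^ (-k)) with hD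
  have hfm : Measurable f := by fun_prop
  have hgm : Measurable g := by fun_prop
  -- The residual is orthogonal to the fitted part, and σ² cancels in the quadratic form of z. The
  -- likelihood therefore factorizes into a function of the precision and a function of z, so the
  -- two stay independent after reweighting.
  have hdens : (fun r => fracLik h.α X y (Ψ r)) =ᵐ[(gammaMeasure h.a₀ h.b₀).prod
      (stdGaussian (EuclideanSpace ℝ S))] (D • fun r => f r.1 * g r.2) := by
    have hae := (Measure.quasiMeasurePreserving_fst (μ := gammaMeasure h.a₀ h.b₀)
      (ν := stdGaussian (EuclideanSpace ℝ S))).ae (ae_pos_gammaMeasure h.a₀ h.b₀)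
    filter_upwards [hae] with r hr
    simp only [hΨ, fracLik, Pi.smul_apply, smul_eq_mul, hf, hg, hD]
    rw [norm_sq_sub_extend hG, ← ENNReal.ofReal_mul (by positivity),
      ← ENNReal.ofReal_mul (by positivity)]
    congr 1
    have e1 : (√(r.1⁻¹) • WithLp.toLp 2 (A *ᵥ r.2.ofLp) : EuclideanSpace ℝ S).ofLp ⬝ᵥ
        gram X S *ᵥ (√(r.1⁻¹) • WithLp.toLp 2 (A *ᵥ r.2.ofLp) : EuclideanSpace ℝ S).ofLp =
        r.1⁻¹ * (h.γ⁻¹ * ‖r.2‖ ^ 2) := by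
      have e2 := sqrt_mulVec_gram hG hγ r.2.ofLp
      rw [← norm_sq_toLp r.2.ofLp] at e2
      rw [WithLp.ofLp_smul, Matrix.mulVec_smul, smul_dotProduct, dotProduct_smul, smul_smul,
        Real.mul_self_sqrt (inv_pos.2 hr).le, smul_eq_mul, e2]
    rw [e1, show -((n : ℝ) * h.α / 2) = -k by rfl, Real.mul_rpow (by positivity) (by positivity),
      Real.inv_rpow hr.le, Real.rpow_neg hr.le, inv_inv, mul_assoc, mul_assoc, ← Real.exp_add]
    congr 3
    rw [hb]
    field_simp
    ring
  refine ⟨D * (ENNReal.ofReal (h.b₀ ^ h.a₀ / Real.Gamma h.a₀ *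
    (Real.Gamma (h.a₀ + k) / (h.b₀ + b) ^ (h.a₀ + k))) * C₁), ?_⟩
  rw [hprior, ← map_withDensity_comp hΨm (measurable_fracLik _ _ _), withDensity_congr_ae hdens,
    withDensity_smul _ (by fun_prop), ← prod_withDensity hfm hgm, hgam, hC₁, Measure.map_smul,
    Measure.prod_smul_left, Measure.prod_smul_right, Measure.map_smul, Measure.map_smul, smul_smul,
    smul_smul]
  congr 1
  · ring
  · have hηm : Measurable fun z : EuclideanSpace ℝ S => η • z := by fun_prop
    rw [← Measure.map_id (μ := gammaMeasure (h.a₀ + k) (h.b₀ + b)), Measure.map_prod_map _ _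
      measurable_id hηm, Measure.map_map hΨm (measurable_id.prodMap hηm), Measure.map_id]
    rfl

end sqrt

/-! ### The posterior as a mixture over models -/

/-- The prior law given the model `S`, projected to `β` after reweighting by the fractional
likelihood. -/
noncomputable def modelWeight (h : Hyper) (X : Matrix (Fin n) (Fin p) ℝ)
    (y : EuclideanSpace ℝ (Fin n)) (S : Finset (Fin p)) : Measure (EuclideanSpace ℝ (Fin p)) :=
  ((priorGiven h X y S).withDensity (fracLik h.α X y)).map Prod.fst

/-- The empirical prior depends on y only through the centre β̂_S. It is the image of a law free of
y under a map jointly measurable in y and the random variables, so measurability in y follows from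
Tonelli's theorem. Markov's inequality for functions of y relies on this. -/
theorem measurable_modelWeight (h : Hyper) (X : Matrix (Fin n) (Fin p) ℝ) (S : Finset (Fin p))
    {A : Set (EuclideanSpace ℝ (Fin p))} (hA : MeasurableSet A) :
    Measurable fun y => modelWeight h X y S A := by
  have hA' : MeasurableSet (Prod.fst ⁻¹' A : Set (EuclideanSpace ℝ (Fin p) × ℝ)) :=
    measurable_fst hA
  have hl := (continuous_lse X S).measurable
  have he := (continuous_extend S).measurable
  have hm : Measurable fun r : EuclideanSpace ℝ (Fin n) × (ℝ × EuclideanSpace ℝ S) =>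
      (extend S (lse X S r.1 + √r.2.1 • r.2.2), r.2.1) := by
    refine Measurable.prodMk (he.comp ?_) (by fun_prop)
    have hs : Measurable fun r : EuclideanSpace ℝ (Fin n) × (ℝ × EuclideanSpace ℝ S) =>
      √r.2.1 • r.2.2 := by fun_prop
    exact (hl.comp measurable_fst).add hs
  have hf : Measurable fun r : EuclideanSpace ℝ (Fin n) × (EuclideanSpace ℝ (Fin p) × ℝ) =>
      (Prod.fst ⁻¹' A).indicator (fracLik h.α X r.1) r.2 := by
    have : (fun r : EuclideanSpace ℝ (Fin n) × (EuclideanSpace ℝ (Fin p) × ℝ) =>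
        (Prod.fst ⁻¹' A).indicator (fracLik h.α X r.1) r.2) =
        (Prod.snd ⁻¹' (Prod.fst ⁻¹' A)).indicator fun r => fracLik h.α X r.1 r.2 := rfl
    rw [this]
    exact (measurable_fracLik_uncurry h.α X).indicator (measurable_snd hA')
  have hsf : SFinite (invGamma h.a₀ h.b₀) := by
    unfold invGamma gammaMeasure; infer_instance
  have hsg : IsProbabilityMeasure (multivariateGaussian (0 : EuclideanSpace ℝ S)
    (h.γ⁻¹ • (gram X S)⁻¹)) := inferInstance
  have hfin := (hf.comp (measurable_fst.prodMk hm)).lintegral_prod_right'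
    (ν := (invGamma h.a₀ h.b₀).prod (multivariateGaussian 0 (h.γ⁻¹ • (gram X S)⁻¹)))
  have hmy : ∀ y : EuclideanSpace ℝ (Fin n), Measurable fun q : ℝ × EuclideanSpace ℝ S =>
      (extend S (lse X S y + √q.1 • q.2), q.1) := by
    intro y
    refine Measurable.prodMk (he.comp ?_) (by fun_prop)
    have hs : Measurable fun q : ℝ × EuclideanSpace ℝ S => √q.1 • q.2 := by fun_prop
    exact measurable_const.add hs
  convert hfin using 2 with y
  rw [modelWeight, Measure.map_apply measurable_fst hA, withDensity_apply _ hA',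
    ← lintegral_indicator hA', priorGiven, lintegral_map]
  · rfl
  · exact (measurable_fracLik h.α X y).indicator hA'
  · exact hmy y

theorem posterior_eq_sum (h : Hyper) (X : Matrix (Fin n) (Fin p) ℝ) (y : EuclideanSpace ℝ (Fin n)) :
    posterior h X y = (evidence h X y)⁻¹ •
      ∑ S : Finset (Fin p), ENNReal.ofReal (modelPrior h X S) • modelWeight h X y S := by
  rw [posterior]
  congr 1
  ext A hA
  have hA' : MeasurableSet (Prod.fst ⁻¹' A : Set (EuclideanSpace ℝ (Fin p) × ℝ)) :=
    measurable_fst hA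
  rw [Measure.map_apply measurable_fst hA, withDensity_apply _ hA', prior,
    ← lintegral_indicator hA', lintegral_finsetSum_measure, Measure.finsetSum_apply]
  refine Finset.sum_congr rfl fun S _ => ?_
  rw [lintegral_smul_measure, lintegral_indicator hA', Measure.smul_apply, modelWeight,
    Measure.map_apply measurable_fst hA, withDensity_apply _ hA']

theorem evidence_eq_sum (h : Hyper) (X : Matrix (Fin n) (Fin p) ℝ) (y : EuclideanSpace ℝ (Fin n)) :
    evidence h X y =
      ∑ S : Finset (Fin p), ENNReal.ofReal (modelPrior h X S) * modelWeight h X y S Set.univ := by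
  rw [evidence, prior, lintegral_finsetSum_measure]
  refine Finset.sum_congr rfl fun S _ => ?_
  rw [lintegral_smul_measure, modelWeight, Measure.map_apply measurable_fst MeasurableSet.univ,
    withDensity_apply _ (measurable_fst MeasurableSet.univ)]
  simp

theorem modelPosterior_eq (h : Hyper) (X : Matrix (Fin n) (Fin p) ℝ)
    (y : EuclideanSpace ℝ (Fin n)) (S : Finset (Fin p)) :
    modelPosterior h X y S = (evidence h X y)⁻¹ *
      (ENNReal.ofReal (modelPrior h X S) * modelWeight h X y S Set.univ) := by
  rw [modelPosterior, modelWeight, Measure.map_apply measurable_fst MeasurableSet.univ,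
    withDensity_apply _ (measurable_fst MeasurableSet.univ), mul_comm, div_eq_mul_inv, mul_comm]
  simp [mul_comm]

theorem measurable_evidence (h : Hyper) (X : Matrix (Fin n) (Fin p) ℝ) :
    Measurable (evidence h X) := by
  have : evidence h X = fun y => ∑ S : Finset (Fin p),
      ENNReal.ofReal (modelPrior h X S) * modelWeight h X y S Set.univ := by
    ext y; exact evidence_eq_sum h X y
  rw [this]
  exact Finset.measurable_sum _ fun S _ =>
    (measurable_modelWeight h X S MeasurableSet.univ).const_mul _

theorem measurable_posterior (h : Hyper) (X : Matrix (Fin n) (Fin p) ℝ)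
    {A : Set (EuclideanSpace ℝ (Fin p))} (hA : MeasurableSet A) :
    Measurable fun y => posterior h X y A := by
  simp only [posterior_eq_sum, Measure.smul_apply, Measure.finsetSum_apply, smul_eq_mul]
  exact (measurable_evidence h X).inv.mul (Finset.measurable_sum _ fun S _ =>
    (measurable_modelWeight h X S hA).const_mul _)

theorem measurable_modelPosterior (h : Hyper) (X : Matrix (Fin n) (Fin p) ℝ) (S : Finset (Fin p)) :
    Measurable fun y => modelPosterior h X y S := by
  simp only [modelPosterior_eq]
  exact (measurable_evidence h X).inv.mul
    ((measurable_modelWeight h X S MeasurableSet.univ).const_mul _)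

theorem posterior_univ (h : Hyper) (X : Matrix (Fin n) (Fin p) ℝ) (y : EuclideanSpace ℝ (Fin n)) :
    posterior h X y Set.univ = (evidence h X y)⁻¹ * evidence h X y := by
  rw [posterior_eq_sum, Measure.smul_apply, Measure.finsetSum_apply, evidence_eq_sum]
  rfl

/-- The total mass is e⁻¹e in `ℝ≥0∞`, which is 0 when the evidence e is 0 or ∞ and 1 otherwise.
Excluding total mass 0 therefore suffices, and no separate proof that the evidence is positive and
finite is needed. -/
theorem posterior_univ_eq_one {h : Hyper} {X : Matrix (Fin n) (Fin p) ℝ}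
    {y : EuclideanSpace ℝ (Fin n)} (h0 : posterior h X y Set.univ ≠ 0) :
    posterior h X y Set.univ = 1 := by
  rw [posterior_univ] at h0 ⊢
  exact ENNReal.inv_mul_cancel (right_ne_zero_of_mul h0)
    (ENNReal.inv_ne_zero.1 (left_ne_zero_of_mul h0))

theorem posterior_univ_le_one (h : Hyper) (X : Matrix (Fin n) (Fin p) ℝ)
    (y : EuclideanSpace ℝ (Fin n)) : posterior h X y Set.univ ≤ 1 := by
  by_cases h0 : posterior h X y Set.univ = 0
  · rw [h0]; exact zero_le
  · exact (posterior_univ_eq_one h0).le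

theorem modelPosterior_le_posterior_univ (h : Hyper) (X : Matrix (Fin n) (Fin p) ℝ)
    (y : EuclideanSpace ℝ (Fin n)) (S : Finset (Fin p)) :
    modelPosterior h X y S ≤ posterior h X y Set.univ := by
  rw [modelPosterior_eq, posterior_univ]
  gcongr
  rw [evidence_eq_sum]
  exact Finset.single_le_sum (f := fun S => ENNReal.ofReal (modelPrior h X S) *
    modelWeight h X y S Set.univ) (fun _ _ => zero_le) (Finset.mem_univ S)

/-- If `Q` is the posterior law given the model `S`, the posterior is at most
`Q + (1 - π^n(S))`. -/
theorem posterior_le_add (h : Hyper) (X : Matrix (Fin n) (Fin p) ℝ) (y : EuclideanSpace ℝ (Fin n))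
    (S : Finset (Fin p)) {C : ℝ≥0∞} {Q : Measure (EuclideanSpace ℝ (Fin p))}
    [IsProbabilityMeasure Q] (hQ : modelWeight h X y S = C • Q)
    (A : Set (EuclideanSpace ℝ (Fin p))) :
    posterior h X y A ≤ Q A + (1 - modelPosterior h X y S) := by
  have hm1 : modelPosterior h X y S ≤ 1 :=
    (modelPosterior_le_posterior_univ h X y S).trans (posterior_univ_le_one h X y)
  have hmt : modelPosterior h X y S ≠ ∞ := ne_top_of_le_ne_top ENNReal.one_ne_top hm1
  have hsum : ∀ B, posterior h X y B = (evidence h X y)⁻¹ *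
      (ENNReal.ofReal (modelPrior h X S) * modelWeight h X y S B) + (evidence h X y)⁻¹ *
      ∑ T ∈ Finset.univ.erase S, ENNReal.ofReal (modelPrior h X T) * modelWeight h X y T B := by
    intro B
    rw [posterior_eq_sum, Measure.smul_apply, Measure.finsetSum_apply, smul_eq_mul, ← mul_add,
      ← Finset.add_sum_erase _ _ (Finset.mem_univ S)]
    rfl
  have hu := hsum Set.univ
  rw [← modelPosterior_eq] at hu
  rw [hsum A]
  refine add_le_add ?_ ?_
  · have : (evidence h X y)⁻¹ * (ENNReal.ofReal (modelPrior h X S) * modelWeight h X y S A) =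
        modelPosterior h X y S * Q A := by
      rw [modelPosterior_eq, hQ]
      simp only [Measure.smul_apply, smul_eq_mul, measure_univ, mul_one]
      ring
    rw [this]
    exact mul_le_of_le_one_left zero_le hm1
  -- The other models give A at most their total mass, which together with π^n(S) is at most 1.
  · refine ENNReal.le_sub_of_add_le_left hmt ?_
    refine le_trans ?_ (hu ▸ posterior_univ_le_one h X y)
    gcongr
    exact Set.subset_univ _

/-! ### From the posterior to the coverage of its quantile -/

theorem measurableSet_inner_lt (x : EuclideanSpace ℝ (Fin p)) (θ : ℝ) :
    MeasurableSet {β : EuclideanSpace ℝ (Fin p) | inner ℝ x β < θ} :=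
  measurableSet_lt (by fun_prop) measurable_const

theorem le_postQuantile {h : Hyper} {X : Matrix (Fin n) (Fin p) ℝ} {x : EuclideanSpace ℝ (Fin p)}
    {δ θ : ℝ} (hδ : 0 < δ) {y : EuclideanSpace ℝ (Fin n)} (h1 : posterior h X y Set.univ = 1)
    (hθ : (posterior h X y).real {β | inner ℝ x β < θ} < 1 - δ) :
    θ ≤ postQuantile h X x δ y := by
  have hp : IsProbabilityMeasure (posterior h X y) := ⟨h1⟩
  have hm : Measurable fun β : EuclideanSpace ℝ (Fin p) => inner ℝ x β := by fun_prop
  have hp' : IsProbabilityMeasure ((posterior h X y).map fun β => inner ℝ x β) :=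
    Measure.isProbabilityMeasure_map hm.aemeasurable
  -- Nonemptiness matters because `sInf ∅ = 0`; it holds since the distribution function tends to 1
  -- > 1 - δ. A level t < θ cannot belong to the set, because {xᵀβ ≤ t} ⊆ {xᵀβ < θ}.
  refine le_csInf ?_ fun t ht => ?_
  · have ht := tendsto_cdf_atTop ((posterior h X y).map fun β => inner ℝ x β)
    obtain ⟨t, ht⟩ := (ht.eventually_const_lt (by linarith : 1 - δ < 1)).exists
    rw [cdf_eq_real, map_measureReal_apply hm measurableSet_Iic] at ht
    exact ⟨t, ht.le⟩
  · by_contra! hlt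
    have : postCdf h X y x t ≤ (posterior h X y).real {β | inner ℝ x β < θ} :=
      measureReal_mono fun β hβ => lt_of_le_of_lt hβ hlt
    have h2 : 1 - δ ≤ postCdf h X y x t := ht
    linarith

theorem gaussianReal_Ici_neg (z : ℝ) :
    (gaussianReal 0 1).real (Set.Ici (-z)) = (gaussianReal 0 1).real (Set.Iic z) := by
  have h := gaussianReal_map_neg (μ := 0) (v := 1)
  rw [neg_zero] at h
  conv_lhs => rw [← h]
  rw [map_measureReal_apply measurable_neg measurableSet_Ici]
  congr 1; ext x; simp

instance isProbabilityMeasure_responseLaw (X : Matrix (Fin n) (Fin p) ℝ)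
    (β : EuclideanSpace ℝ (Fin p)) (σ : ℝ) : IsProbabilityMeasure (responseLaw X β σ) := by
  unfold responseLaw; infer_instance

theorem inner_restr_supp (x β : EuclideanSpace ℝ (Fin p)) :
    inner ℝ (restr (supp β) x) (restr (supp β) β) = inner ℝ x β := by
  rw [← inner_extend, extend_restr_supp]

/-- The estimation error is -σ·`lseScale`·g with g standard normal, and g ≥ -z has probability Φ(z)
by symmetry. Only an inequality is available in general: if the scale vanishes, the event is
everything. -/
theorem le_responseLaw_lse {X : Matrix (Fin n) (Fin p) ℝ} {β : EuclideanSpace ℝ (Fin p)}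
    (hG : IsUnit (gram X (supp β)).det) {σ : ℝ} (hσ : 0 ≤ σ) (x : EuclideanSpace ℝ (Fin p))
    (z : ℝ) :
    (gaussianReal 0 1).real (Set.Iic z) ≤ (responseLaw X β σ).real
      {y | inner ℝ x β - inner ℝ (restr (supp β) x) (lse X (supp β) y) ≤
        σ * lseScale X (supp β) x * z} := by
  have hl := (continuous_lse X (supp β)).measurable
  have hE : MeasurableSet {y : EuclideanSpace ℝ (Fin n) |
      inner ℝ x β - inner ℝ (restr (supp β) x) (lse X (supp β) y) ≤
        σ * lseScale X (supp β) x * z} :=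
    measurableSet_le (measurable_const.sub (measurable_const.inner hl)) measurable_const
  have hs : MeasurableSet {s : ℝ | -(σ * s) ≤ σ * lseScale X (supp β) x * z} :=
    measurableSet_le (by fun_prop) measurable_const
  rw [responseLaw_eq_map X β hσ, map_measureReal_apply (by fun_prop) hE]
  have h1 : (fun e => WithLp.toLp 2 (X *ᵥ β.ofLp) + σ • e) ⁻¹' {y : EuclideanSpace ℝ (Fin n) |
      inner ℝ x β - inner ℝ (restr (supp β) x) (lse X (supp β) y) ≤
        σ * lseScale X (supp β) x * z} =
      (fun e => inner ℝ (restr (supp β) x) (lse X (supp β) e)) ⁻¹'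
        {s : ℝ | -(σ * s) ≤ σ * lseScale X (supp β) x * z} := by
    ext e
    simp only [Set.mem_preimage, Set.mem_ofPred_eq, lse_add, lse_mulVec_supp hG, lse_smul,
      inner_add_right, inner_restr_supp, inner_smul_right]
    ring_nf
  rw [h1, ← map_measureReal_apply (measurable_const.inner hl) hs, stdGaussian_map_inner_lse hG,
    map_measureReal_apply (by fun_prop) hs, ← gaussianReal_Ici_neg]
  refine measureReal_mono fun g hg => ?_
  simp only [Set.mem_preimage, Set.mem_ofPred_eq]
  have h2 : -z ≤ g := hg
  nlinarith [mul_nonneg hσ (lseScale_nonneg X (supp β) x)]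

/-- Here B collects the responses where the posterior approximation fails. Monotonicity and
subadditivity suffice, so neither B nor the coverage event has to be measurable. -/
theorem sub_le_coverage {h : Hyper} {X : Matrix (Fin n) (Fin p) ℝ} {β : EuclideanSpace ℝ (Fin p)}
    (hG : IsUnit (gram X (supp β)).det) {σ : ℝ} (hσ : 0 ≤ σ) {x : EuclideanSpace ℝ (Fin p)}
    {δ z : ℝ} (hδ : 0 < δ) {B : Set (EuclideanSpace ℝ (Fin n))}
    (hB : ∀ y ∉ B, inner ℝ x β - inner ℝ (restr (supp β) x) (lse X (supp β) y) ≤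
        σ * lseScale X (supp β) x * z → posterior h X y Set.univ = 1 ∧
          (posterior h X y).real {b | inner ℝ x b < inner ℝ x β} < 1 - δ) :
    (gaussianReal 0 1).real (Set.Iic z) - (responseLaw X β σ).real B ≤ coverage h X β σ x δ := by
  have h1 := le_responseLaw_lse hG hσ x z
  have h2 : (responseLaw X β σ).real
      {y | inner ℝ x β - inner ℝ (restr (supp β) x) (lse X (supp β) y) ≤
        σ * lseScale X (supp β) x * z} ≤ (responseLaw X β σ).real
      ({y | inner ℝ x β ≤ postQuantile h X x δ y} ∪ B) := by
    refine measureReal_mono fun y hy => ?_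
    by_cases hyB : y ∈ B
    · exact Or.inr hyB
    · obtain ⟨h3, h4⟩ := hB y hyB hy
      exact Or.inl (le_postQuantile hδ h3 h4)
  have h3 := measureReal_union_le (μ := responseLaw X β σ)
    {y | inner ℝ x β ≤ postQuantile h X x δ y} B
  unfold coverage
  linarith

theorem exists_isLittleO_of_eventually_le {c : ℕ → ℝ} {m : ℝ}
    (hc : ∀ η > 0, ∀ᶠ n in atTop, m - η ≤ c n) :
    ∃ r : ℕ → ℝ, r =o[atTop] (fun _ => (1 : ℝ)) ∧ ∀ n, m + r n ≤ c n := by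
  -- Truncating at 0 discards any excess over m, so that only the vanishing shortfall remains.
  refine ⟨fun n => min (c n - m) 0, ?_, fun n => ?_⟩
  · rw [isLittleO_one_iff, Metric.tendsto_nhds]
    intro ε hε
    filter_upwards [hc (ε / 2) (by linarith)] with n hn
    rw [Real.dist_0_eq_abs, abs_lt]
    constructor
    · rcases min_choice (c n - m) 0 with h | h <;> rw [h] <;> linarith
    · exact lt_of_le_of_lt (min_le_right _ _) hε
  · have := min_le_left (c n - m) 0
    linarith

/-! ### Coverage from the normal approximation in total variation -/

theorem normalApprox_apply {h : Hyper} {X : Matrix (Fin n) (Fin p) ℝ} {S : Finset (Fin p)}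
    (hG : IsUnit (gram X S).det) (hκ : 0 < h.α + h.γ) {σ : ℝ} (hσ : 0 ≤ σ)
    (y : EuclideanSpace ℝ (Fin n)) (x : EuclideanSpace ℝ (Fin p)) (θ : ℝ) :
    normalApprox h X y S σ {b | inner ℝ x b < θ} = gaussianReal 0 1
      {g | inner ℝ (restr S x) (lse X S y) + σ / √(h.α + h.γ) * lseScale X S x * g < θ} := by
  have hV : ((σ ^ 2 / (h.α + h.γ)) • (gram X S)⁻¹).PosSemidef :=
    ((posDef_gram hG).inv.posSemidef).smul (by positivity)
  have hs : MeasurableSet {s : ℝ | s < θ} := measurableSet_Iio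
  rw [normalApprox, Measure.map_apply (continuous_extend S).measurable (measurableSet_inner_lt x θ)]
  have h1 : extend S ⁻¹' {b | inner ℝ x b < θ} =
      (fun b => inner ℝ (restr S x) b) ⁻¹' {s : ℝ | s < θ} := by
    ext b; simp [inner_extend]
  have h2 : √((restr S x).ofLp ⬝ᵥ ((σ ^ 2 / (h.α + h.γ)) • (gram X S)⁻¹) *ᵥ (restr S x).ofLp) =
      σ / √(h.α + h.γ) * lseScale X S x := by
    rw [Matrix.smul_mulVec, dotProduct_smul, smul_eq_mul, Real.sqrt_mul (by positivity), lseScale,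
      Real.sqrt_div (by positivity), Real.sqrt_sq hσ]
  rw [h1, ← Measure.map_apply (by fun_prop) hs, multivariateGaussian_map_inner hV, h2,
    Measure.map_apply (by fun_prop) hs]
  rfl

theorem le_tvDist {E : Type*} [MeasurableSpace E] (μ ν : Measure E) {A : Set E}
    (hA : MeasurableSet A) : ENNReal.ofReal |μ.real A - ν.real A| ≤ tvDist μ ν :=
  le_iSup₂_of_le A hA le_rfl

theorem gaussianReal_affine_lt_le {m τ θ q : ℝ} (hτ : 0 ≤ τ) (hθ : θ - m ≤ τ * q) :
    (gaussianReal 0 1).real {g | m + τ * g < θ} ≤ (gaussianReal 0 1).real (Set.Iic q) := by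
  refine measureReal_mono fun g hg => ?_
  by_contra hgq
  have h1 : q < g := not_le.1 hgq
  have h2 : m + τ * g < θ := hg
  nlinarith

instance isProbabilityMeasure_normalApprox (h : Hyper) (X : Matrix (Fin n) (Fin p) ℝ)
    (y : EuclideanSpace ℝ (Fin n)) (S : Finset (Fin p)) (σ : ℝ) :
    IsProbabilityMeasure (normalApprox h X y S σ) :=
  Measure.isProbabilityMeasure_map (continuous_extend S).measurable.aemeasurable

/-- Markov's inequality is applied to the discrepancy on two fixed sets rather than to `tvDist`, so
measurability of the supremum is not needed. The half-line controls the posterior mass below θ; the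
whole space rules out a posterior of total mass 0, whose discrepancy there would be 1 > δ. -/
theorem coverage_ge_of_tvDist {h : Hyper} (hκ : 0 < h.α + h.γ) {X : Matrix (Fin n) (Fin p) ℝ}
    {β : EuclideanSpace ℝ (Fin p)} (hG : IsUnit (gram X (supp β)).det) {σ : ℝ} (hσ : 0 ≤ σ)
    (x : EuclideanSpace ℝ (Fin p)) {δ q ε : ℝ} (hδ : 0 < δ) (hδ1 : δ < 1) (hε : 0 < ε)
    (hq : (gaussianReal 0 1).real (Set.Iic q) + ε ≤ 1 - δ) {t : ℝ} (ht : 0 ≤ t)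
    (hT : ∫⁻ y, tvDist (posterior h X y) (normalApprox h X y (supp β) σ) ∂responseLaw X β σ ≤
      ENNReal.ofReal t) :
    (gaussianReal 0 1).real (Set.Iic (q / √(h.α + h.γ))) - (t / ε + t / δ) ≤
      coverage h X β σ x δ := by
  set A : Set (EuclideanSpace ℝ (Fin p)) := {b | inner ℝ x b < inner ℝ x β} with hA
  have hAm : MeasurableSet A := measurableSet_inner_lt x _
  set ν := fun y => normalApprox h X y (supp β) σ with hν
  have hl := (continuous_lse X (supp β)).measurable
  have hνA : Measurable fun y => (ν y).real A := by
    simp only [hν, hA, measureReal_def, normalApprox_apply hG hκ hσ]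
    refine Measurable.ennreal_toReal ?_
    have hset : MeasurableSet {r : EuclideanSpace ℝ (Fin n) × ℝ |
        inner ℝ (restr (supp β) x) (lse X (supp β) r.1) +
          σ / √(h.α + h.γ) * lseScale X (supp β) x * r.2 < inner ℝ x β} := by
      refine measurableSet_lt (Measurable.add ?_ (by fun_prop)) measurable_const
      exact measurable_const.inner (hl.comp measurable_fst)
    exact measurable_measure_prodMk_left hset
  have key : ∀ (C : Set (EuclideanSpace ℝ (Fin p))) (hC : MeasurableSet C)
      (_ : Measurable fun y => (ν y).real C) (e : ℝ) (_ : 0 < e),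
      (responseLaw X β σ).real {y | e ≤ |(posterior h X y).real C - (ν y).real C|} ≤ t / e := by
    intro C hC hνC e he
    have hm : Measurable fun y => ENNReal.ofReal |(posterior h X y).real C - (ν y).real C| := by
      have := (measurable_posterior h X hC).ennreal_toReal
      exact ((this.sub hνC).abs).ennreal_ofReal
    have h1 := meas_ge_le_lintegral_div (μ := responseLaw X β σ) hm.aemeasurable
      (ENNReal.ofReal_pos.2 he).ne' ENNReal.ofReal_ne_top
    have h2 : ∫⁻ y, ENNReal.ofReal |(posterior h X y).real C - (ν y).real C| ∂responseLaw X β σ ≤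
        ENNReal.ofReal t :=
      (lintegral_mono fun y => le_tvDist _ _ hC).trans hT
    have h3 : responseLaw X β σ {y | e ≤ |(posterior h X y).real C - (ν y).real C|} ≤
        ENNReal.ofReal (t / e) := by
      rw [ENNReal.ofReal_div_of_pos he]
      refine le_trans (measure_mono fun y hy => ?_) (h1.trans (ENNReal.div_le_div_right h2 _))
      exact ENNReal.ofReal_le_ofReal hy
    exact ENNReal.toReal_le_of_le_ofReal (by positivity) h3
  have k1 := key A hAm hνA ε hε
  have k2 := key Set.univ MeasurableSet.univ
    (by simp only [hν, probReal_univ]; exact measurable_const) δ hδ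
  have hU := measureReal_union_le (μ := responseLaw X β σ)
    {y | ε ≤ |(posterior h X y).real A - (ν y).real A|}
    {y | δ ≤ |(posterior h X y).real Set.univ - (ν y).real Set.univ|}
  refine le_trans ?_ (sub_le_coverage (h := h) hG hσ (z := q / √(h.α + h.γ)) hδ (B :=
    {y | ε ≤ |(posterior h X y).real A - (ν y).real A|} ∪
    {y | δ ≤ |(posterior h X y).real Set.univ - (ν y).real Set.univ|}) ?_)
  · linarith
  · intro y hy hE
    simp only [Set.mem_union, Set.mem_ofPred_eq, not_or, not_le, hν, probReal_univ] at hy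
    obtain ⟨hy1, hy2⟩ := hy
    constructor
    · refine posterior_univ_eq_one fun h0 => ?_
      rw [measureReal_def, h0] at hy2
      simp at hy2
      linarith
    · have h1 : (normalApprox h X y (supp β) σ).real A ≤ (gaussianReal 0 1).real (Set.Iic q) := by
        rw [measureReal_def, hA, normalApprox_apply hG hκ hσ]
        refine gaussianReal_affine_lt_le
          (mul_nonneg (by positivity) (lseScale_nonneg X (supp β) x)) ?_
        calc _ ≤ _ := hE
          _ = _ := by ring
      have h2 := (abs_lt.1 hy1).2
      linarith

/-! ### The law of `xᵀβ` given a model -/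

theorem map_fst_smul_map_prodMk {A B D : Type*} [MeasurableSpace A] [MeasurableSpace B]
    [MeasurableSpace D] (μ : Measure A) (C : ℝ≥0∞) {F : A → B} {G : A → D} (hF : Measurable F)
    (hG : Measurable G) : (C • μ.map fun r => (F r, G r)).map Prod.fst = C • μ.map F := by
  rw [Measure.map_smul, Measure.map_map measurable_fst (hF.prodMk hG)]
  rfl

theorem measurable_extend_scaled (S : Finset (Fin p)) (A : Matrix S S ℝ) (m : EuclideanSpace ℝ S)
    (η : ℝ) : Measurable fun r : ℝ × EuclideanSpace ℝ S =>
      extend S (m + √(r.1⁻¹) • WithLp.toLp 2 (A *ᵥ (η • r.2).ofLp)) := by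
  refine (continuous_extend S).measurable.comp (measurable_const.add ?_)
  have h1 : Measurable fun r : ℝ × EuclideanSpace ℝ S => √(r.1⁻¹) := by fun_prop
  have h2 : Measurable fun r : ℝ × EuclideanSpace ℝ S => η • r.2 := by fun_prop
  exact h1.smul ((continuous_toLp_mulVec A).measurable.comp h2)

/-- Given the precision, only one linear functional of the standard normal vector matters, and it is
distributed as its norm times a standard normal variable. This reduces the dimension from |S| + 1 to
2. -/
theorem map_extend_scaled_inner_lt {S : Finset (Fin p)} (Γ : Measure ℝ) [IsProbabilityMeasure Γ]
    {A : Matrix S S ℝ} (hA : Aᵀ = A) (m : EuclideanSpace ℝ S) (η : ℝ)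
    (x : EuclideanSpace ℝ (Fin p)) (θ : ℝ) :
    (Γ.prod (stdGaussian (EuclideanSpace ℝ S))).map (fun r =>
      extend S (m + √(r.1⁻¹) • WithLp.toLp 2 (A *ᵥ (η • r.2).ofLp))) {b | inner ℝ x b < θ} =
    (Γ.prod (gaussianReal 0 1)) {r | inner ℝ (restr S x) m + √(r.1⁻¹) *
      (η * ‖(WithLp.toLp 2 (A *ᵥ (restr S x).ofLp) : EuclideanSpace ℝ S)‖ * r.2) < θ} := by
  set u : EuclideanSpace ℝ S := WithLp.toLp 2 (A *ᵥ (restr S x).ofLp) with hu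
  have hT : MeasurableSet {r : ℝ × ℝ | inner ℝ (restr S x) m + √(r.1⁻¹) * (η * r.2) < θ} :=
    measurableSet_lt (by fun_prop) measurable_const
  have hi : Measurable fun z : EuclideanSpace ℝ S => inner ℝ u z := by fun_prop
  have hi' : Measurable fun g : ℝ => ‖u‖ * g := by fun_prop
  have e1 : (fun r : ℝ × EuclideanSpace ℝ S =>
      extend S (m + √(r.1⁻¹) • WithLp.toLp 2 (A *ᵥ (η • r.2).ofLp))) ⁻¹' {b | inner ℝ x b < θ} =
      Prod.map id (fun z => inner ℝ u z) ⁻¹'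
        {r : ℝ × ℝ | inner ℝ (restr S x) m + √(r.1⁻¹) * (η * r.2) < θ} := by
    ext r
    simp only [Set.mem_preimage, Set.mem_ofPred_eq, inner_extend, inner_add_right,
      inner_smul_right, inner_mulVec_right, hA, Prod.map_fst, Prod.map_snd, id, hu]
  have e2 : Prod.map id (fun g => ‖u‖ * g) ⁻¹'
      {r : ℝ × ℝ | inner ℝ (restr S x) m + √(r.1⁻¹) * (η * r.2) < θ} =
      {r : ℝ × ℝ | inner ℝ (restr S x) m + √(r.1⁻¹) * (η * ‖u‖ * r.2) < θ} := by
    ext r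
    simp only [Set.mem_preimage, Set.mem_ofPred_eq, Prod.map_fst, Prod.map_snd, id, mul_assoc]
  have e3 : (Γ.prod (stdGaussian (EuclideanSpace ℝ S))).map
      (Prod.map id (fun z => inner ℝ u z)) =
      (Γ.prod (gaussianReal 0 1)).map (Prod.map id (fun g => ‖u‖ * g)) := by
    rw [← Measure.map_prod_map _ _ measurable_id hi, stdGaussian_map_inner,
      Measure.map_prod_map _ _ measurable_id hi']
  rw [Measure.map_apply (measurable_extend_scaled S A m η) (measurableSet_inner_lt x θ), e1,
    ← Measure.map_apply (measurable_id.prodMap hi) hT, e3,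
    Measure.map_apply (measurable_id.prodMap hi') hT, e2]

section sqrt

open scoped MatrixOrder

/-- The posterior law of `β` given the model `S`. -/
noncomputable def modelLaw (h : Hyper) (X : Matrix (Fin n) (Fin p) ℝ)
    (y : EuclideanSpace ℝ (Fin n)) (S : Finset (Fin p)) : Measure (EuclideanSpace ℝ (Fin p)) :=
  ((gammaMeasure (h.a₀ + n * h.α / 2) (h.b₀ + h.α / 2 * ‖residual X S y‖ ^ 2)).prod
    (stdGaussian (EuclideanSpace ℝ S))).map fun r =>
      extend S (lse X S y + √(r.1⁻¹) • WithLp.toLp 2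
        (CFC.sqrt (h.γ⁻¹ • (gram X S)⁻¹) *ᵥ (√(h.γ / (h.α + h.γ)) • r.2).ofLp))

theorem isProbabilityMeasure_gammaMeasure_residual {h : Hyper} (ha₀ : 0 < h.a₀) (hb₀ : 0 < h.b₀)
    (hα : 0 < h.α) (X : Matrix (Fin n) (Fin p) ℝ) (S : Finset (Fin p))
    (y : EuclideanSpace ℝ (Fin n)) : IsProbabilityMeasure
      (gammaMeasure (h.a₀ + n * h.α / 2) (h.b₀ + h.α / 2 * ‖residual X S y‖ ^ 2)) :=
  isProbabilityMeasure_gammaMeasure (by positivity) (by positivity)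

theorem isProbabilityMeasure_modelLaw {h : Hyper} (ha₀ : 0 < h.a₀) (hb₀ : 0 < h.b₀)
    (hα : 0 < h.α) (X : Matrix (Fin n) (Fin p) ℝ) (S : Finset (Fin p))
    (y : EuclideanSpace ℝ (Fin n)) : IsProbabilityMeasure (modelLaw h X y S) := by
  have := isProbabilityMeasure_gammaMeasure_residual ha₀ hb₀ hα X S y
  exact Measure.isProbabilityMeasure_map (measurable_extend_scaled _ _ _ _).aemeasurable

theorem exists_modelWeight_eq_smul {h : Hyper} (ha₀ : 0 < h.a₀) (hb₀ : 0 < h.b₀)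
    (hα : 0 < h.α) (hγ : 0 < h.γ) {X : Matrix (Fin n) (Fin p) ℝ} {S : Finset (Fin p)}
    (hG : IsUnit (gram X S).det) (y : EuclideanSpace ℝ (Fin n)) :
    ∃ C : ℝ≥0∞, modelWeight h X y S = C • modelLaw h X y S := by
  obtain ⟨C, hC⟩ := priorGiven_withDensity_fracLik h ha₀ hb₀ hα hγ hG y
  refine ⟨C, ?_⟩
  rw [modelWeight, hC, modelLaw]
  exact map_fst_smul_map_prodMk _ C (measurable_extend_scaled _ _ _ _) (by fun_prop)

/-- The prior scale γ^(-1/2) and the shrinkage √(γ/(α + γ)) multiply to (α + γ)^(-1/2): the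
precisions of the prior and of the fractional likelihood, centred at the same β̂_S, add up. -/
theorem modelLaw_inner_lt {h : Hyper} (ha₀ : 0 < h.a₀) (hb₀ : 0 < h.b₀)
    (hα : 0 < h.α) (hγ : 0 < h.γ) {X : Matrix (Fin n) (Fin p) ℝ} {S : Finset (Fin p)}
    (hG : IsUnit (gram X S).det) (y : EuclideanSpace ℝ (Fin n)) (x : EuclideanSpace ℝ (Fin p))
    (θ : ℝ) :
    modelLaw h X y S {b | inner ℝ x b < θ} =
      ((gammaMeasure (h.a₀ + n * h.α / 2) (h.b₀ + h.α / 2 * ‖residual X S y‖ ^ 2)).prod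
        (gaussianReal 0 1)) {r | inner ℝ (restr S x) (lse X S y) +
          √(r.1⁻¹) * (lseScale X S x / √(h.α + h.γ) * r.2) < θ} := by
  have hp := isProbabilityMeasure_gammaMeasure_residual ha₀ hb₀ hα X S y
  have hV : (h.γ⁻¹ • (gram X S)⁻¹).PosSemidef :=
    ((posDef_gram hG).inv.posSemidef).smul (inv_pos.2 hγ).le
  have hun : √(h.γ / (h.α + h.γ)) * √((restr S x).ofLp ⬝ᵥ
      (h.γ⁻¹ • (gram X S)⁻¹) *ᵥ (restr S x).ofLp) = lseScale X S x / √(h.α + h.γ) := by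
    rw [Matrix.smul_mulVec, dotProduct_smul, smul_eq_mul, Real.sqrt_mul (by positivity),
      lseScale, Real.sqrt_div hγ.le, Real.sqrt_inv]
    have := (Real.sqrt_pos.2 hγ).ne'
    field_simp
  rw [modelLaw, map_extend_scaled_inner_lt _ (transpose_sqrt _), norm_sqrt_mulVec hV, hun]

end sqrt

/-- A scale mixture of normal laws whose scale is close to `σ` with high probability. -/
theorem prod_gaussianReal_lt_le {Γ : Measure ℝ} [IsProbabilityMeasure Γ] {m τ θ σ q q' ρ : ℝ}
    (hτ : 0 ≤ τ) (hσ : 0 < σ) (hρ1 : ρ ≤ 1) (hθ : θ - m ≤ σ * τ * q)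
    (hq : ∀ u : ℝ, |u - 1| < ρ → q * √u ≤ q') :
    (Γ.prod (gaussianReal 0 1)) {r | m + √(r.1⁻¹) * (τ * r.2) < θ} ≤
      Γ {t | ρ ≤ |t * σ ^ 2 - 1|} + gaussianReal 0 1 (Set.Iic q') := by
  have hsub : {r : ℝ × ℝ | m + √(r.1⁻¹) * (τ * r.2) < θ} ⊆
      ({t | ρ ≤ |t * σ ^ 2 - 1|} ×ˢ Set.univ) ∪ (Set.univ ×ˢ Set.Iic q') := by
    rintro ⟨t, g⟩ hr
    simp only [Set.mem_ofPred_eq] at hr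
    by_cases ht : ρ ≤ |t * σ ^ 2 - 1|
    · exact Or.inl ⟨ht, trivial⟩
    · refine Or.inr ⟨trivial, ?_⟩
      rw [not_le] at ht
      have h1 := (abs_lt.1 ht).1
      -- |tσ² - 1| < ρ ≤ 1 forces tσ² > 0.
      have ht0 : 0 < t := by
        by_contra! hneg
        nlinarith [sq_nonneg σ]
      have hst := Real.sqrt_pos.2 ht0
      -- Taking u = tσ² turns the bound with scale σ into one with the random scale t^(-1/2).
      have h2 := hq _ ht
      rw [Real.sqrt_mul ht0.le, Real.sqrt_sq hσ.le] at h2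
      rw [Real.sqrt_inv] at hr
      have h3 : (√t)⁻¹ * (τ * g) < σ * τ * q := by linarith
      have h4 : τ * g < σ * τ * q * √t := by
        rw [inv_mul_lt_iff₀ hst] at h3
        linarith
      have h5 : τ * g < τ * q' := by
        calc τ * g < σ * τ * q * √t := h4
          _ = τ * (q * (√t * σ)) := by ring
          _ ≤ τ * q' := mul_le_mul_of_nonneg_left h2 hτ
      exact (lt_of_mul_lt_mul_left h5 hτ).le
  refine (measure_mono hsub).trans ((measure_union_le _ _).trans ?_)
  rw [Measure.prod_prod, Measure.prod_prod, measure_univ, measure_univ, mul_one, one_mul]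

theorem gammaMeasure_abs_mul_sub_one_le {a r σ ρ : ℝ} (ha : 0 < a) (hr : 0 < r) (hσ : 0 < σ)
    (hρ : 0 < ρ) (hρ1 : ρ ≤ 1) (hm : |a * σ ^ 2 / r - 1| ≤ ρ / 2) :
    gammaMeasure a r {t | ρ ≤ |t * σ ^ 2 - 1|} ≤ ENNReal.ofReal (9 / (a * ρ ^ 2)) := by
  have hσ2 : 0 < σ ^ 2 := by positivity
  refine (measure_mono fun t ht => ?_).trans ((gammaMeasure_abs_sub_mean_ge_le ha hr
    (ρ := ρ / 2 / σ ^ 2) (by positivity)).trans (ENNReal.ofReal_le_ofReal ?_))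
  · simp only [Set.mem_ofPred_eq] at ht ⊢
    have h0 : |(t - a / r) * σ ^ 2| = |t - a / r| * σ ^ 2 := by rw [abs_mul, abs_of_pos hσ2]
    rw [div_le_iff₀ hσ2, ← h0]
    have h1 : t * σ ^ 2 - 1 = (t - a / r) * σ ^ 2 + (a * σ ^ 2 / r - 1) := by ring
    have h2 := abs_add_le ((t - a / r) * σ ^ 2) (a * σ ^ 2 / r - 1)
    rw [← h1] at h2
    linarith
  · have h1 := (abs_le.1 hm).2
    have h0 : 0 < a * σ ^ 2 / r := by positivity
    -- The ratio is at most 1 + ρ/2 ≤ 3/2. With the factor 4 from halving the tolerance, this gives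
    -- the constant 9.
    have h2 : (a * σ ^ 2 / r) ^ 2 ≤ 9 / 4 := by nlinarith
    have h3 : a / r ^ 2 / (ρ / 2 / σ ^ 2) ^ 2 = (a * σ ^ 2 / r) ^ 2 * (4 / (a * ρ ^ 2)) := by
      field_simp
      ring
    rw [h3]
    calc _ ≤ 9 / 4 * (4 / (a * ρ ^ 2)) := by gcongr
      _ = _ := by ring

/-! ### Concentration of the residual sum of squares -/

/-- The mean Xβ lies in the column space of the true model, so the fit removes it and only the noise
remains. -/
theorem residual_response {X : Matrix (Fin n) (Fin p) ℝ} {β : EuclideanSpace ℝ (Fin p)}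
    (hG : IsUnit (gram X (supp β)).det) (σ : ℝ) (e : EuclideanSpace ℝ (Fin n)) :
    residual X (supp β) (WithLp.toLp 2 (X *ᵥ β.ofLp) + σ • e) = σ • residual X (supp β) e := by
  have h := mulVec_extend X (supp β) (restr (supp β) β)
  rw [extend_restr_supp] at h
  simp only [residual]
  rw [lse_add, lse_mulVec_supp hG, lse_smul, WithLp.ofLp_add, WithLp.ofLp_smul, Matrix.mulVec_add,
    Matrix.mulVec_smul, h, WithLp.toLp_add, WithLp.toLp_smul, smul_sub]
  abel

theorem norm_sq_residual {X : Matrix (Fin n) (Fin p) ℝ} {S : Finset (Fin p)}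
    (hG : IsUnit (gram X S).det) (e : EuclideanSpace ℝ (Fin n)) :
    ‖residual X S e‖ ^ 2 = ‖e‖ ^ 2 -
      ‖(WithLp.toLp 2 (cols X S *ᵥ (lse X S e).ofLp) : EuclideanSpace ℝ (Fin n))‖ ^ 2 := by
  have h1 : e = residual X S e + WithLp.toLp 2 (cols X S *ᵥ (lse X S e).ofLp) := by
    simp [residual]
  have h2 := norm_add_sq_real (residual X S e)
    (WithLp.toLp 2 (cols X S *ᵥ (lse X S e).ofLp) : EuclideanSpace ℝ (Fin n))
  rw [← h1, residual_orthogonal hG] at h2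
  linarith

theorem integrable_and_integral_inner_sq_stdGaussian {E : Type*} [NormedAddCommGroup E]
    [InnerProductSpace ℝ E] [FiniteDimensional ℝ E] [MeasurableSpace E] [BorelSpace E] (u : E) :
    Integrable (fun e => inner ℝ u e ^ 2) (stdGaussian E) ∧
      ∫ e, inner ℝ u e ^ 2 ∂stdGaussian E = ‖u‖ ^ 2 := by
  have hL : MemLp (innerSL ℝ u) 2 (stdGaussian E) :=
    (innerSL ℝ u).comp_memLp' IsGaussian.memLp_two_id
  have hv := variance_dual_stdGaussian (innerSL ℝ u)
  rw [variance_eq_sub hL, integral_strongDual_stdGaussian, innerSL_apply_norm] at hv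
  refine ⟨hL.integrable_sq, ?_⟩
  simpa using hv

/-- The expected squared norm of the projection of a standard normal vector onto the column space
is the number of columns. -/
theorem integrable_and_integral_norm_sq_fit {X : Matrix (Fin n) (Fin p) ℝ} {S : Finset (Fin p)}
    (hG : IsUnit (gram X S).det) :
    Integrable (fun e => ‖(WithLp.toLp 2 (cols X S *ᵥ (lse X S e).ofLp) :
      EuclideanSpace ℝ (Fin n))‖ ^ 2) (stdGaussian (EuclideanSpace ℝ (Fin n))) ∧
    ∫ e, ‖(WithLp.toLp 2 (cols X S *ᵥ (lse X S e).ofLp) : EuclideanSpace ℝ (Fin n))‖ ^ 2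
      ∂stdGaussian (EuclideanSpace ℝ (Fin n)) = S.card := by
  set P : Matrix (Fin n) (Fin n) ℝ := cols X S * (gram X S)⁻¹ * (cols X S)ᵀ with hP
  have hfit : ∀ e : EuclideanSpace ℝ (Fin n),
      ‖(WithLp.toLp 2 (cols X S *ᵥ (lse X S e).ofLp) : EuclideanSpace ℝ (Fin n))‖ ^ 2 =
        ∑ i, inner ℝ (WithLp.toLp 2 (P i) : EuclideanSpace ℝ (Fin n)) e ^ 2 := by
    intro e
    rw [EuclideanSpace.real_norm_sq_eq]
    refine Finset.sum_congr rfl fun i _ => ?_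
    congr 1
    simp only [lse, Matrix.mulVec_mulVec, inner_eq_dotProduct]
    rw [hP, ← Matrix.mul_assoc]
    rfl
  have hPt : Pᵀ = P := by
    rw [hP, Matrix.transpose_mul, Matrix.transpose_mul, Matrix.transpose_transpose,
      Matrix.transpose_nonsing_inv, transpose_gram, Matrix.mul_assoc]
  have hPP : P * P = P := by
    have : P * P = cols X S * ((gram X S)⁻¹ * ((cols X S)ᵀ * cols X S)) *
        (gram X S)⁻¹ * (cols X S)ᵀ := by
      rw [hP]; simp only [Matrix.mul_assoc]
    rw [this, ← gram, Matrix.nonsing_inv_mul _ hG, Matrix.mul_one]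
  have htr : P.trace = S.card := by
    rw [hP, Matrix.trace_mul_comm, ← Matrix.mul_assoc, ← gram, Matrix.mul_nonsing_inv _ hG,
      Matrix.trace_one]
    simp
  -- P is a symmetric idempotent, so the sum of its squared row norms is tr(PPᵀ) = tr P, which
  -- equals |S| by cyclicity of the trace.
  have hsum : ∑ i, ‖(WithLp.toLp 2 (P i) : EuclideanSpace ℝ (Fin n))‖ ^ 2 = S.card := by
    rw [← htr]
    conv_rhs => rw [← hPP]
    refine Finset.sum_congr rfl fun i _ => ?_
    rw [norm_sq_toLp, Matrix.diag_apply, Matrix.mul_apply]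
    refine Finset.sum_congr rfl fun j _ => ?_
    congr 1
    conv_lhs => rw [← hPt]
    rfl
  simp only [hfit]
  refine ⟨integrable_finsetSum _ fun i _ => (integrable_and_integral_inner_sq_stdGaussian _).1, ?_⟩
  rw [integral_finsetSum _ fun i _ => (integrable_and_integral_inner_sq_stdGaussian _).1, ← hsum]
  exact Finset.sum_congr rfl fun i _ => (integrable_and_integral_inner_sq_stdGaussian _).2

/-- The variance of the square of a standard normal variable. -/
noncomputable def chiSqVariance : ℝ := Var[fun t : ℝ => t ^ 2; gaussianReal 0 1]

theorem memLp_sq_gaussianReal : MemLp (fun t : ℝ => t ^ 2) 2 (gaussianReal 0 1) := by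
  have h4 := memLp_id_gaussianReal (μ := 0) (v := 1) 4
  rw [memLp_two_iff_integrable_sq (by fun_prop)]
  have := h4.integrable_norm_pow (by norm_num)
  refine this.congr (ae_of_all _ fun t => ?_)
  simp only [id, Real.norm_eq_abs]
  rw [← pow_mul, show 2 * 2 = 4 from rfl, Even.pow_abs (by decide)]

/-- Chebyshev's inequality for a sum of n independent squares with mean 1. Only the linear growth of
the variance in n matters, so its constant is left unevaluated. -/
theorem stdGaussian_norm_sq_sub_ge_le {ε : ℝ} (hε : 0 < ε) :
    (stdGaussian (EuclideanSpace ℝ (Fin n))).real {e | ε ≤ |‖e‖ ^ 2 - n|} ≤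
      n * chiSqVariance / ε ^ 2 := by
  have hL : Measurable (WithLp.toLp 2 : (Fin n → ℝ) → EuclideanSpace ℝ (Fin n)) :=
    WithLp.measurable_toLp 2 _
  have hm1 : ∫ t, t ^ 2 ∂gaussianReal 0 1 = 1 := by
    have := variance_eq_sub (memLp_id_gaussianReal (μ := 0) (v := 1) 2)
    rw [variance_id_gaussianReal] at this
    simpa using this.symm
  have hmem : MemLp (∑ i, fun z : Fin n → ℝ => z i ^ 2) 2
      (Measure.pi fun _ : Fin n => gaussianReal 0 1) :=
    memLp_finsetSum' _ fun i _ => memLp_sq_gaussianReal.comp_measurePreserving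
      (measurePreserving_eval (fun _ : Fin n => gaussianReal 0 1) i)
  have hvar := variance_sum_pi (μ := fun _ : Fin n => gaussianReal 0 1)
    (X := fun _ t => t ^ 2) fun _ => memLp_sq_gaussianReal
  have hmean : ∫ z, (∑ i, fun z : Fin n → ℝ => z i ^ 2) z
      ∂(Measure.pi fun _ : Fin n => gaussianReal 0 1) = n := by
    simp only [Finset.sum_apply]
    rw [integral_finsetSum]
    · have : ∀ i : Fin n, ∫ z : Fin n → ℝ, z i ^ 2 ∂(Measure.pi fun _ : Fin n => gaussianReal 0 1) =
          1 := fun i => by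
        rw [← hm1]
        exact integral_comp_eval (μ := fun _ : Fin n => gaussianReal 0 1) (i := i)
          (f := fun t => t ^ 2) (by fun_prop)
      simp [this]
    · intro i _
      exact integrable_comp_eval (μ := fun _ : Fin n => gaussianReal 0 1) (i := i)
        (f := fun t => t ^ 2) (memLp_sq_gaussianReal.integrable (by norm_num))
  have hch := meas_ge_le_variance_div_sq hmem hε
  rw [hmean, hvar] at hch
  have hset : MeasurableSet {e : EuclideanSpace ℝ (Fin n) | ε ≤ |‖e‖ ^ 2 - n|} :=
    measurableSet_le measurable_const (by fun_prop)
  rw [← map_pi_eq_stdGaussian, map_measureReal_apply hL hset]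
  refine ENNReal.toReal_le_of_le_ofReal
    (div_nonneg (mul_nonneg (Nat.cast_nonneg _) (variance_nonneg _ _)) (sq_nonneg _)) ?_
  refine le_trans (measure_mono fun z hz => ?_) (hch.trans (ENNReal.ofReal_le_ofReal ?_))
  · simp only [Set.mem_preimage, Set.mem_ofPred_eq, EuclideanSpace.real_norm_sq_eq] at hz
    simpa using hz
  · simp [chiSqVariance]

/-- By Pythagoras the scaled residual sum of squares is ‖e‖² minus the squared norm of the fitted
noise. Half of the tolerance goes to Chebyshev's inequality for ‖e‖², and half to Markov's
inequality for the fit, whose mean is the model size. -/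
theorem responseLaw_residual_le {X : Matrix (Fin n) (Fin p) ℝ} {β : EuclideanSpace ℝ (Fin p)}
    (hG : IsUnit (gram X (supp β)).det) {σ : ℝ} (hσ : 0 < σ) (hn : 0 < n) {ρ : ℝ} (hρ : 0 < ρ) :
    (responseLaw X β σ).real
      {y | ρ * n ≤ |‖residual X (supp β) y‖ ^ 2 / σ ^ 2 - n|} ≤
      4 * chiSqVariance / ρ ^ 2 * (1 / n) + 2 / ρ * ((supp β).card / n) := by
  have hn' : (0 : ℝ) < n := Nat.cast_pos.2 hn
  have hr := (continuous_residual X (supp β)).measurable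
  have hset : MeasurableSet
      {y | ρ * n ≤ |‖residual X (supp β) y‖ ^ 2 / σ ^ 2 - n|} :=
    measurableSet_le measurable_const
      ((((hr.norm).pow_const 2).div_const _).sub measurable_const).abs
  rw [responseLaw_eq_map X β hσ.le, map_measureReal_apply (by fun_prop) hset]
  obtain ⟨hi, he⟩ := integrable_and_integral_norm_sq_fit hG
  have h1 := stdGaussian_norm_sq_sub_ge_le (n := n) (ε := ρ * n / 2) (by positivity)
  have h2 := mul_meas_ge_le_integral_of_nonneg (ae_of_all _ fun e => sq_nonneg _) hi (ρ * n / 2)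
  rw [he] at h2
  set F := fun e : EuclideanSpace ℝ (Fin n) =>
    ‖(WithLp.toLp 2 (cols X (supp β) *ᵥ (lse X (supp β) e).ofLp) : EuclideanSpace ℝ (Fin n))‖ ^ 2
    with hF
  have h3 : (stdGaussian (EuclideanSpace ℝ (Fin n))).real {e | ρ * n / 2 ≤ F e} ≤
      2 / ρ * ((supp β).card / n) := by
    have e1 : 2 / ρ * (((supp β).card : ℝ) / n) = (supp β).card / (ρ * n / 2) := by
      field_simp
    rw [e1, le_div_iff₀ (by positivity), mul_comm]
    exact h2
  have h4 : n * chiSqVariance / (ρ * n / 2) ^ 2 = 4 * chiSqVariance / ρ ^ 2 * (1 / n) := by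
    field_simp
    ring
  rw [h4] at h1
  refine le_trans ((measureReal_mono fun e he => ?_).trans (measureReal_union_le
    {e : EuclideanSpace ℝ (Fin n) | ρ * n / 2 ≤ |‖e‖ ^ 2 - n|} {e | ρ * n / 2 ≤ F e}))
    (add_le_add h1 h3)
  simp only [Set.mem_preimage, Set.mem_ofPred_eq, residual_response hG, norm_smul, mul_pow,
    Real.norm_eq_abs, sq_abs] at he
  rw [mul_div_cancel_left₀ _ (by positivity), norm_sq_residual hG] at he
  by_contra hcon
  simp only [Set.mem_union, Set.mem_ofPred_eq, not_or, not_le] at hcon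
  obtain ⟨c1, c2⟩ := hcon
  have c3 : 0 ≤ F e := sq_nonneg _
  have c4 : |‖e‖ ^ 2 - F e - n| < ρ * n := by
    rw [abs_lt] at c1 ⊢
    constructor <;> linarith
  linarith

/-! ### Coverage from model selection consistency -/

/-- The numerator of the difference is at most Nρ/4 + Nρ/8 = 3Nρ/8 in absolute value. The
denominator is at least 7N/8, and 3/8 ≤ (1/2)(7/8). -/
theorem abs_ratio_sub_one_le {a N b r ρ : ℝ} (ha : 0 < a) (hb : 0 < b) (hN : 0 < N)
    (hρ1 : ρ ≤ 1) (hr : |r - 1| < ρ / 8) (hab : a + b ≤ N * ρ / 4) :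
    |(a + N) / (b + N * r) - 1| ≤ ρ / 2 := by
  obtain ⟨h1, h2⟩ := abs_lt.1 hr
  have hρ : 0 < ρ := by linarith
  have h3 : N * (7 / 8) ≤ N * r := mul_le_mul_of_nonneg_left (by linarith) hN.le
  have hD : 0 < b + N * r := by linarith
  have h4 : (a + N) / (b + N * r) - 1 = (a - b - N * (r - 1)) / (b + N * r) := by
    field_simp
    ring
  rw [h4, abs_div, abs_of_pos hD, div_le_iff₀ hD, abs_le]
  have h5 : N * (r - 1) ≤ N * (ρ / 8) := mul_le_mul_of_nonneg_left h2.le hN.le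
  have h6 : N * -(ρ / 8) ≤ N * (r - 1) := mul_le_mul_of_nonneg_left h1.le hN.le
  have h7 : ρ / 2 * (N * (7 / 8)) ≤ ρ / 2 * (b + N * r) := by gcongr; linarith
  constructor <;> nlinarith

/-- Off two exceptional events, one for the residual and one for the model probability, the
posterior mass below θ is at most Φ(q') + 2ε. One ε pays for the deviation of the gamma precision
and one for the other models. The third ε in the hypothesis on q' makes the final bound strictly
less than 1 - δ. -/
theorem coverage_ge_of_modelPosterior {h : Hyper} (ha₀ : 0 < h.a₀) (hb₀ : 0 < h.b₀)
    (hα : 0 < h.α) (hγ : 0 < h.γ) {X : Matrix (Fin n) (Fin p) ℝ}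
    {β : EuclideanSpace ℝ (Fin p)} (hG : IsUnit (gram X (supp β)).det) {σ : ℝ} (hσ : 0 < σ)
    (x : EuclideanSpace ℝ (Fin p)) {δ q q' ε ρ : ℝ} (hδ : 0 < δ) (hε : 0 < ε) (hε1 : ε < 1)
    (hρ : 0 < ρ) (hρ1 : ρ ≤ 1) (hq : ∀ u : ℝ, |u - 1| < ρ → q * √u ≤ q')
    (hq' : (gaussianReal 0 1).real (Set.Iic q') + 3 * ε ≤ 1 - δ) (hn : 0 < n)
    (hab : h.a₀ + h.b₀ / σ ^ 2 ≤ n * h.α / 2 * ρ / 4)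
    (hnε : 9 / ((h.a₀ + n * h.α / 2) * ρ ^ 2) ≤ ε) {t : ℝ} (ht : 0 ≤ t)
    (hT : 1 - ENNReal.ofReal t ≤ ∫⁻ y, modelPosterior h X y (supp β) ∂responseLaw X β σ) :
    (gaussianReal 0 1).real (Set.Iic (q / √(h.α + h.γ))) -
      (4 * chiSqVariance / (ρ / 8) ^ 2 * (1 / n) + 2 / (ρ / 8) * ((supp β).card / n) + t / ε) ≤
      coverage h X β σ x δ := by
  have hn' : (0 : ℝ) < n := Nat.cast_pos.2 hn
  set B₁ := {y | ρ / 8 * n ≤ |‖residual X (supp β) y‖ ^ 2 / σ ^ 2 - n|} with hB₁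
  set B₂ := {y | ENNReal.ofReal ε ≤ 1 - modelPosterior h X y (supp β)} with hB₂
  have k1 := responseLaw_residual_le hG hσ hn (ρ := ρ / 8) (by positivity)
  have hm := measurable_modelPosterior h X (supp β)
  have hm1 : ∀ y, modelPosterior h X y (supp β) ≤ 1 := fun y =>
    (modelPosterior_le_posterior_univ h X y _).trans (posterior_univ_le_one h X y)
  have k2 : (responseLaw X β σ).real B₂ ≤ t / ε := by
    have h1 := meas_ge_le_lintegral_div (μ := responseLaw X β σ)
      (f := fun y => 1 - modelPosterior h X y (supp β)) (measurable_const.sub hm).aemeasurable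
      (ENNReal.ofReal_pos.2 hε).ne' ENNReal.ofReal_ne_top
    have hle : ∫⁻ y, modelPosterior h X y (supp β) ∂responseLaw X β σ ≤ 1 :=
      (lintegral_mono hm1).trans (by simp)
    have h2 : ∫⁻ y, (1 - modelPosterior h X y (supp β)) ∂responseLaw X β σ ≤ ENNReal.ofReal t := by
      rw [lintegral_sub hm (ne_top_of_le_ne_top ENNReal.one_ne_top hle) (ae_of_all _ hm1)]
      simp only [lintegral_const, measure_univ, mul_one]
      rw [tsub_le_iff_left]
      exact tsub_le_iff_right.1 hT
    refine ENNReal.toReal_le_of_le_ofReal (by positivity) ?_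
    rw [ENNReal.ofReal_div_of_pos hε]
    exact h1.trans (ENNReal.div_le_div_right h2 _)
  have hU := measureReal_union_le (μ := responseLaw X β σ) B₁ B₂
  refine le_trans ?_ (sub_le_coverage (h := h) hG hσ.le (z := q / √(h.α + h.γ)) hδ
    (B := B₁ ∪ B₂) ?_)
  · linarith
  intro y hy hE
  simp only [hB₁, hB₂, Set.mem_union, Set.mem_ofPred_eq, not_or, not_le] at hy
  obtain ⟨hy1, hy2⟩ := hy
  have hone : posterior h X y Set.univ = 1 := by
    refine posterior_univ_eq_one fun h0 => ?_
    have h1 := modelPosterior_le_posterior_univ h X y (supp β)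
    rw [h0, nonpos_iff_eq_zero] at h1
    rw [h1, tsub_zero, ENNReal.lt_ofReal_iff_toReal_lt ENNReal.one_ne_top] at hy2
    simp at hy2
    linarith
  refine ⟨hone, ?_⟩
  obtain ⟨C, hQ⟩ := exists_modelWeight_eq_smul ha₀ hb₀ hα hγ hG y
  have hQp := isProbabilityMeasure_modelLaw ha₀ hb₀ hα X (supp β) y
  have hpost := posterior_le_add h X y (supp β) hQ {b | inner ℝ x b < inner ℝ x β}
  rw [modelLaw_inner_lt ha₀ hb₀ hα hγ hG] at hpost
  set a' := h.a₀ + n * h.α / 2 with ha'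
  set b' := h.b₀ + h.α / 2 * ‖residual X (supp β) y‖ ^ 2 with hb'
  have ha'0 : 0 < a' := by positivity
  have hb'0 : 0 < b' := by positivity
  have hp := isProbabilityMeasure_gammaMeasure ha'0 hb'0
  have hmix := prod_gaussianReal_lt_le (Γ := gammaMeasure a' b')
    (m := inner ℝ (restr (supp β) x) (lse X (supp β) y)) (θ := inner ℝ x β) (q := q) (q' := q')
    (τ := lseScale X (supp β) x / √(h.α + h.γ)) (σ := σ) (ρ := ρ)
    (div_nonneg (lseScale_nonneg _ _ _) (Real.sqrt_nonneg _)) hσ hρ1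
    (by calc _ ≤ _ := hE
          _ = _ := by ring) hq
  have hratio : |a' * σ ^ 2 / b' - 1| ≤ ρ / 2 := by
    set R := ‖residual X (supp β) y‖ ^ 2 / σ ^ 2 with hR
    -- Dividing by σ² gives the form (a + N)/(b + Nr) with N = nα/2 and r = ‖residual‖²/(nσ²), where
    -- r is within ρ/8 of 1.
    have e1 : a' * σ ^ 2 / b' =
        (h.a₀ + n * h.α / 2) / (h.b₀ / σ ^ 2 + n * h.α / 2 * (R / n)) := by
      have e2 : b' = σ ^ 2 * (h.b₀ / σ ^ 2 + n * h.α / 2 * (R / n)) := by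
        rw [hb', hR]; field_simp
      rw [e2, mul_comm a', mul_div_mul_left _ _ (by positivity)]
    rw [e1]
    refine abs_ratio_sub_one_le ha₀ (by positivity) (by positivity) hρ1 ?_ hab
    have e3 : R / n - 1 = (R - n) / n := by field_simp
    rw [e3, abs_div, abs_of_pos hn', div_lt_iff₀ hn']
    exact hy1
  have hg := gammaMeasure_abs_mul_sub_one_le ha'0 hb'0 hσ hρ hρ1 hratio
  have hfin : posterior h X y {b | inner ℝ x b < inner ℝ x β} ≤
      ENNReal.ofReal (ε + (gaussianReal 0 1).real (Set.Iic q') + ε) := by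
    rw [ENNReal.ofReal_add (by positivity) hε.le, ENNReal.ofReal_add hε.le (by positivity),
      ofReal_measureReal]
    refine hpost.trans (add_le_add (hmix.trans (add_le_add ?_ le_rfl)) hy2.le)
    exact hg.trans (ENNReal.ofReal_le_ofReal hnε)
  have := ENNReal.toReal_le_of_le_ofReal (by positivity) hfin
  change (posterior h X y).real _ ≤ _ at this
  linarith

theorem tendsto_div_of_isLittleO {s : ℕ → ℝ}
    (hs : s =o[atTop] fun n : ℕ => √(n : ℝ) / Real.log n) :
    Tendsto (fun n => s n / n) atTop (𝓝 0) := by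
  have hO : (fun n : ℕ => √(n : ℝ) / Real.log n) =O[atTop] fun n : ℕ => (n : ℝ) := by
    refine IsBigO.of_bound 1 ?_
    -- From n = 3 > e on, log n ≥ 1.
    filter_upwards [eventually_ge_atTop 3] with n hn
    have hn3 : (3 : ℝ) ≤ n := by exact_mod_cast hn
    have hlog : 1 ≤ Real.log n := by
      rw [Real.le_log_iff_exp_le (by linarith)]
      linarith [Real.exp_one_lt_d9]
    rw [one_mul, Real.norm_of_nonneg (by positivity), Real.norm_of_nonneg (by positivity)]
    calc √(n : ℝ) / Real.log n ≤ √(n : ℝ) := div_le_self (Real.sqrt_nonneg _) hlog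
      _ ≤ n := by
        rw [Real.sqrt_le_left (by linarith)]
        nlinarith
  exact (hs.trans_isBigO hO).tendsto_div_nhds_zero

theorem coverage_of_tendsto_tvDist
    (h : EmpiricalPrior.Hyper) (hα₀ : 0 < h.α) (hγ : 0 < h.γ) (hαγ : h.α + h.γ ≤ 1)
    (δ : ℝ) (hδ₀ : 0 < δ) (hδ₁ : δ < 1) (hδ : δ ≤ 1 / 2 ∨ h.α + h.γ = 1)
    (p : ℕ → ℕ) (X : (n : ℕ) → Matrix (Fin n) (Fin (p n)) ℝ)
    (βs : (n : ℕ) → EuclideanSpace ℝ (Fin (p n))) (σ₀ : ℕ → ℝ)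
    (x : (n : ℕ) → EuclideanSpace ℝ (Fin (p n)))
    (hX : ∀ n, ∀ S : Finset (Fin (p n)), S.card ≤ (X n).rank → IsUnit (gram (X n) S).det)
    (hσ₀ : ∀ n, 0 < σ₀ n)
    (hs : ∀ᶠ n in atTop, (supp (βs n)).card ≤ (X n).rank)
    (hT : Tendsto (fun n => ∫⁻ y, tvDist (posterior h (X n) y)
          (normalApprox h (X n) y (supp (βs n)) (σ₀ n))
          ∂responseLaw (X n) (βs n) (σ₀ n)) atTop (𝓝 0)) :
    ∃ r : ℕ → ℝ, r =o[atTop] (fun _ => (1 : ℝ)) ∧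
        ∀ n, 1 - δ + r n ≤ coverage h (X n) (βs n) (σ₀ n) (x n) δ := by
  refine exists_isLittleO_of_eventually_le fun η hη => ?_
  have hκ : 0 < h.α + h.γ := by positivity
  obtain ⟨q', q'', hqq, hq1, hq2⟩ := exists_quantile_gaussianReal hδ₀ hδ₁ hκ hαγ hδ (half_pos hη)
  have hq3 := strictMono_gaussianReal_Iic hqq
  simp only at hq3
  set ε := 1 - δ - (gaussianReal 0 1).real (Set.Iic q') with hε
  have hε0 : 0 < ε := by linarith
  -- This makes the two Markov errors add up to η/2; the other half of η is the loss in the choice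
  -- of quantile.
  set t := η / 2 / (1 / ε + 1 / δ) with ht
  have ht0 : 0 < t := by positivity
  have hte : t / ε + t / δ = η / 2 := by
    rw [ht]; field_simp
  filter_upwards [hs, hT.eventually_lt_const (ENNReal.ofReal_pos.2 ht0)] with n hn hTn
  have := coverage_ge_of_tvDist (h := h) hκ (hX n _ hn) (hσ₀ n).le (x n) hδ₀ hδ₁ hε0
    (q := q') (by linarith) ht0.le hTn.le
  linarith

theorem coverage_of_tendsto_modelPosterior
    (h : EmpiricalPrior.Hyper) (ha₀ : 0 < h.a₀) (hb₀ : 0 < h.b₀)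
    (hα₀ : 0 < h.α) (hγ : 0 < h.γ) (hαγ : h.α + h.γ ≤ 1)
    (δ : ℝ) (hδ₀ : 0 < δ) (hδ₁ : δ < 1) (hδ : δ ≤ 1 / 2 ∨ h.α + h.γ = 1)
    (p : ℕ → ℕ) (X : (n : ℕ) → Matrix (Fin n) (Fin (p n)) ℝ)
    (βs : (n : ℕ) → EuclideanSpace ℝ (Fin (p n))) (σ₀ : ℕ → ℝ)
    (x : (n : ℕ) → EuclideanSpace ℝ (Fin (p n)))
    (hX : ∀ n, ∀ S : Finset (Fin (p n)), S.card ≤ (X n).rank → IsUnit (gram (X n) S).det)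
    (hσ₀ : ∀ n, 0 < σ₀ n)
    (hs : ∀ᶠ n in atTop, (supp (βs n)).card ≤ (X n).rank)
    {d : ℝ} (hd : 0 < d) (hdσ : ∀ n, d < σ₀ n ^ 2)
    (hcard : Tendsto (fun n => ((supp (βs n)).card : ℝ) / n) atTop (𝓝 0))
    (hT : Tendsto (fun n => ∫⁻ y, modelPosterior h (X n) y (supp (βs n))
          ∂responseLaw (X n) (βs n) (σ₀ n)) atTop (𝓝 1)) :
    ∃ r : ℕ → ℝ, r =o[atTop] (fun _ => (1 : ℝ)) ∧
        ∀ n, 1 - δ + r n ≤ coverage h (X n) (βs n) (σ₀ n) (x n) δ := by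
  refine exists_isLittleO_of_eventually_le fun η hη => ?_
  have hκ : 0 < h.α + h.γ := by positivity
  obtain ⟨q', q'', hqq, hq1, hq2⟩ := exists_quantile_gaussianReal hδ₀ hδ₁ hκ hαγ hδ (half_pos hη)
  set ε := (1 - δ - (gaussianReal 0 1).real (Set.Iic q'')) / 3 with hε
  have hε0 : 0 < ε := by rw [hε]; linarith
  have hε1 : ε < 1 := by
    have : 0 ≤ (gaussianReal 0 1).real (Set.Iic q'') := measureReal_nonneg
    rw [hε]; linarith
  -- The gap between q' and q'' absorbs the random scale. Continuity of √ at 1 is used instead of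
  -- monotonicity, because q' may be negative.
  obtain ⟨ρ, hρ0, hρ1, hρ⟩ : ∃ ρ : ℝ, 0 < ρ ∧ ρ ≤ 1 ∧ ∀ u : ℝ, |u - 1| < ρ → q' * √u ≤ q'' := by
    have hc : Tendsto (fun u : ℝ => q' * √u) (𝓝 1) (𝓝 q') := by
      have hc' : Continuous fun u : ℝ => q' * √u := by fun_prop
      simpa using hc'.tendsto 1
    obtain ⟨ρ, hρ, hball⟩ := Metric.eventually_nhds_iff.1 (hc.eventually_lt_const hqq)
    exact ⟨min ρ 1, lt_min hρ one_pos, min_le_right _ _,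
      fun u hu => (hball (lt_of_lt_of_le hu (min_le_left _ _))).le⟩
  -- Error budget: η/2 for the quantile, η/4 for the model probability and η/4 for the residual.
  set t := ε * (η / 4) with ht
  have ht0 : 0 < t := by positivity
  have hte : t / ε = η / 4 := by rw [ht]; field_simp
  have hnat := tendsto_natCast_atTop_atTop (R := ℝ)
  have hlim : Tendsto (fun n : ℕ => 4 * chiSqVariance / (ρ / 8) ^ 2 * (1 / (n : ℝ)) +
      2 / (ρ / 8) * (((supp (βs n)).card : ℝ) / n)) atTop (𝓝 0) := by
    have := (tendsto_one_div_atTop_nhds_zero_nat (𝕜 := ℝ)).const_mul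
      (4 * chiSqVariance / (ρ / 8) ^ 2) |>.add (hcard.const_mul (2 / (ρ / 8)))
    simpa using this
  have hT' : ∀ᶠ n in atTop, 1 - ENNReal.ofReal t < ∫⁻ y, modelPosterior h (X n) y (supp (βs n))
      ∂responseLaw (X n) (βs n) (σ₀ n) :=
    hT.eventually_const_lt (ENNReal.sub_lt_self ENNReal.one_ne_top one_ne_zero
      (ENNReal.ofReal_pos.2 ht0).ne')
  have hab : ∀ᶠ n : ℕ in atTop, h.a₀ + h.b₀ / d ≤ n * h.α / 2 * ρ / 4 := by
    filter_upwards [hnat.eventually_ge_atTop ((h.a₀ + h.b₀ / d) / (h.α * ρ / 8))] with n hn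
    rw [div_le_iff₀ (by positivity)] at hn
    linarith
  have hnε : ∀ᶠ n : ℕ in atTop, 9 / ((h.a₀ + n * h.α / 2) * ρ ^ 2) ≤ ε := by
    filter_upwards [hnat.eventually_ge_atTop (9 / (ε * (h.α / 2 * ρ ^ 2)))] with n hn
    rw [div_le_iff₀ (by positivity)] at hn ⊢
    have : 0 ≤ ε * (h.a₀ * ρ ^ 2) := by positivity
    linarith
  filter_upwards [hs, hT', hlim.eventually_lt_const (by positivity : 0 < η / 4), hab, hnε,
    eventually_gt_atTop 0] with n hn hTn hln habn hnεn hn0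
  have hbd : h.b₀ / σ₀ n ^ 2 ≤ h.b₀ / d := by
    gcongr
    exact (hdσ n).le
  have := coverage_ge_of_modelPosterior ha₀ hb₀ hα₀ hγ (hX n _ hn) (hσ₀ n) (x n) hδ₀ hε0 hε1 hρ0
    hρ1 hρ (by rw [hε]; linarith) hn0 (by linarith) hnεn ht0.le hTn.le
  linarith

end EmpiricalPrior

theorem corollary2
    -- the constants of the prior and of the fractional likelihood, and the level
    (h : EmpiricalPrior.Hyper) (ha : 0 < h.a) (hc : 0 < h.c) (ha₀ : 0 < h.a₀) (hb₀ : 0 < h.b₀)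
    (hα₀ : 0 < h.α) (hα₁ : h.α < 1) (hγ : 0 < h.γ) (hαγ : h.α + h.γ ≤ 1)
    (δ : ℝ) (hδ₀ : 0 < δ) (hδ₁ : δ < 1) (hδ : δ ≤ 1 / 2 ∨ h.α + h.γ = 1)
    -- for each sample size n: the dimension, the design, the truth and the vector x
    (p : ℕ → ℕ) (X : (n : ℕ) → Matrix (Fin n) (Fin (p n)) ℝ)
    (βs : (n : ℕ) → EuclideanSpace ℝ (Fin (p n))) (σ₀ : ℕ → ℝ)
    (x : (n : ℕ) → EuclideanSpace ℝ (Fin (p n)))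
    (hX : ∀ n, ∀ S : Finset (Fin (p n)), S.card ≤ (X n).rank →
      IsUnit (EmpiricalPrior.gram (X n) S).det)
    (hσ₀ : ∀ n, 0 < σ₀ n)
    (hs : ∀ᶠ n in atTop, (EmpiricalPrior.supp (βs n)).card ≤ (X n).rank) :
    -- the total variation form of the Bernstein–von Mises theorem implies valid coverage
    (Tendsto (fun n => ∫⁻ y, EmpiricalPrior.tvDist (EmpiricalPrior.posterior h (X n) y)
          (EmpiricalPrior.normalApprox h (X n) y (EmpiricalPrior.supp (βs n)) (σ₀ n))
          ∂EmpiricalPrior.responseLaw (X n) (βs n) (σ₀ n)) atTop (𝓝 0) →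
      ∃ r : ℕ → ℝ, r =o[atTop] (fun _ => (1 : ℝ)) ∧
        ∀ n, 1 - δ + r n ≤ EmpiricalPrior.coverage h (X n) (βs n) (σ₀ n) (x n) δ) ∧
    -- and so do the conditions of the Bernstein–von Mises theorem
    ((∃ d₁ d₂ : ℝ, 0 < d₁ ∧ ∀ n, d₁ < σ₀ n ^ 2 ∧ σ₀ n ^ 2 < d₂) →
      (fun n : ℕ => ((EmpiricalPrior.supp (βs n)).card : ℝ)) =o[atTop]
        (fun n : ℕ => √(n : ℝ) / Real.log n) →
      Tendsto (fun n => ∫⁻ y,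
          EmpiricalPrior.modelPosterior h (X n) y (EmpiricalPrior.supp (βs n))
          ∂EmpiricalPrior.responseLaw (X n) (βs n) (σ₀ n)) atTop (𝓝 1) →
      ∃ r : ℕ → ℝ, r =o[atTop] (fun _ => (1 : ℝ)) ∧
        ∀ n, 1 - δ + r n ≤ EmpiricalPrior.coverage h (X n) (βs n) (σ₀ n) (x n) δ) := by
  refine ⟨fun hT => EmpiricalPrior.coverage_of_tendsto_tvDist h hα₀ hγ hαγ δ hδ₀ hδ₁ hδ p X βs σ₀ x
    hX hσ₀ hs hT, ?_⟩
  rintro ⟨d₁, d₂, hd₁, hd⟩ hcard hT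
  exact EmpiricalPrior.coverage_of_tendsto_modelPosterior h ha₀ hb₀ hα₀ hγ hαγ δ hδ₀ hδ₁ hδ p X βs
    σ₀ x hX hσ₀ hs hd₁ (fun n => (hd n).1) (EmpiricalPrior.tendsto_div_of_isLittleO hcard) hT
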